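/- **Conventions.** A *graph* is a set $V$ with a binary relation $E$ (self-loops allowed), i.e. a structure for the signature $\sigma=\{E\}$; $\mathbf{Gph}$ is the category of graphs and homomorphisms. A *forest* is a poset in which every set $\{y\mid y\le x\}$ is a finite chain; forest morphisms are the functions preserving roots (minimal elements) and the covering relation $\prec$; $\mathbf{Forest}$ is the resulting category. Given a (weak) factorisation system $(\mathcal Q,\mathcal M)$ (members of $\mathcal Q$ are called quotients, members of $\mathcal M$ embeddings), a *path* is an object whose poset of isomorphism classes of embeddings into it is a finite chain. The system is *stable* if quotients are epimorphisms, embeddings are monomorphisms, and the pullback of any quotient along any embedding exists and is a quotient. A category with a stable factorisation system is *arboreal* if it is locally small and well-powered, its full subcategory of paths is essentially small, and: (i) for paths $P,Q,Q'$, if a composite $P\to Q\to Q'$ is a quotient then so is $P\to Q$; (ii) all coproducts of small families of paths exist; (iii) every arrow from a path to a coproduct of a non-empty family of paths factors through a coproduct map; (iv) every object is the colimit of the canonical diagram of its path embeddings. An adjunction $L\dashv R$ between locally finitely presentable (lfp) categories is *finitely accessible* if $R$ preserves filtered colimits. Let $\mathcal D\subseteq\mathbf{Gph}$ be the full subcategory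 of *deterministic* graphs, in which every vertex has at most one outgoing edge; it is the category of models of the Horn (in particular, cartesian) theory $\{E(x,y)\wedge E(x,z)\vdash_{x,y,z} y=z\}$. Let $\mathcal A\subseteq\mathbf{Forest}$ be the full subcategory of forests in which each node is covered by at most one element, equivalently the forests that are disjoint unions of branches (the comparability relation is an equivalence relation). Let $L^M\colon\mathbf{Forest}\to\mathbf{Gph}$ send a forest to the graph of its covering relation and $R^M\colon\mathbf{Gph}\to\mathbf{Forest}$ send a graph to the forest of its finite non-empty walks, ordered by prefix. **Theorem.** 1. $L^M\dashv R^M$ is a finitely accessible adjunction, and it restricts to an adjunction $L^D\colon\mathcal A\rightleftarrows\mathcal D\colon R^D$. 2. $\mathcal A$ is lfp, and is arboreal with respect to the (surjective, injective) factorisation system. The adjunction $L^D\dashv R^D$ is a finitely accessible arboreal adjunction which detects path embeddings in $\sigma$: $\mathcal D$ is the category of models of a cartesian theory in $\sigma$, all paths of $\mathcal A$ are finitely presentable, and a morphism $f\colon P\to a$ of $\mathcal A$ with $P$ a path is injective if and only if $L^Df$ is an embedding of $\sigma$-structures. 3. The full inclusion $U\colon\mathcal D\to\mathbf{Gph}$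 has a left adjoint $F$, and $F\dashv U$ is finitely accessible. Here $F$ sends $G=(V,E)$ to its quotient by the least equivalence relation $\sim$ on $V$ such that $u\sim u'$, $E(u,v)$ and $E(u',v')$ imply $v\sim v'$; there is an edge between two classes if and only if there is one between some representatives. 4. The adjunction $L^D\dashv R^D$ does not have the factorisation property: there is no finitely accessible adjunction $L\colon\mathcal A\rightleftarrows\mathbf{Gph}\colon R$ such that $L^D\dashv R^D$ is, up to natural isomorphism, the composite of $L\dashv R$ with the reflection $F\dashv U$. Hence the factorisation property fails in general, even for finitely accessible arboreal adjunctions that detect path embeddings. -/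

import Mathlib

open CategoryTheory Limits

universe w v u v' u'

namespace Arboreal

/-! ### Factorisation systems, paths and arboreal categories -/

section Abstract

variable {C : Type u} [Category.{v} C] (Q M : MorphismProperty C)

/-- A stable factorisation system: a weak factorisation system `(Q, M)` which is proper
(quotients are epimorphisms, embeddings are monomorphisms) and such that the pullback of a
quotient along an embedding exists and is a quotient. -/
structure IsStableFactorisationSystem : Prop where
  isWeakFactorisationSystem : MorphismProperty.IsWeakFactorizationSystem Q M
  epi_of_quotient : ∀ {X Y : C} (e : X ⟶ Y), Q e → Epi e
  mono_of_embedding : ∀ {X Y : C} (m : X ⟶ Y), M m → Mono m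
  stable : ∀ {X Y Z : C} (e : X ⟶ Z) (m : Y ⟶ Z), Q e → M m →
    ∃ (W : C) (p : W ⟶ X) (q : W ⟶ Y), IsPullback p q e m ∧ Q q

/-- The poset of isomorphism classes of embeddings into `X`. -/
def Emb (X : C) : Type (max u v) := {S : Subobject X // M S.arrow}

instance (X : C) : PartialOrder (Emb M X) :=
  inferInstanceAs (PartialOrder {S : Subobject X // M S.arrow})

/-- A path is an object whose poset of embeddings is a finite chain. -/
def isPath : ObjectProperty C := fun P =>
  Finite (Emb M P) ∧ ∀ S T : Emb M P, S ≤ T ∨ T ≤ S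

/-- Connected objects: every arrow into a coproduct of a non-empty small family of paths
factors through one of the coproduct maps. -/
def IsConnectedObj (a : C) : Prop :=
  ∀ (I : Type w) [Nonempty I] (P : I → C), (∀ i, isPath M (P i)) →
    ∀ (c : Cofan P), Nonempty (IsColimit c) → ∀ f : a ⟶ c.pt,
      ∃ (i : I) (g : a ⟶ P i), g ≫ c.inj i = f

/-- The objects of `Over a` that are path embeddings `P ↣ a`. In a proper factorisation system
every morphism of `Over a` between two of these is itself an embedding. -/
def isPathEmbedding (a : C) : ObjectProperty (Over a) := fun f =>
  isPath M f.left ∧ M f.hom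

/-- The cocone with vertex `a` over the diagram of all path embeddings into `a`. -/
def pathCocone (a : C) : Cocone ((isPathEmbedding M a).ι ⋙ Over.forget a) :=
  (Over.forgetCocone a).whisker (isPathEmbedding M a).ι

/-- `a` is path-generated if it is the colimit of its path embeddings. -/
def IsPathGenerated (a : C) : Prop := Nonempty (IsColimit (pathCocone M a))

/-- Arboreal categories with quotients `Q` and embeddings `M`; "small" refers to the
universe `w`. -/
structure IsArborealCategory : Prop where
  locallySmall : LocallySmall.{w} C
  wellPowered : WellPowered.{w} C
  stableFactorisationSystem : IsStableFactorisationSystem Q M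
  two_out_of_three : ∀ {P₁ P₂ P₃ : C}, isPath M P₁ → isPath M P₂ → isPath M P₃ →
    ∀ (f : P₁ ⟶ P₂) (g : P₂ ⟶ P₃), Q (f ≫ g) → Q f
  hasCoproducts_paths : ∀ (I : Type w) (P : I → C), (∀ i, isPath M (P i)) → HasCoproduct P
  connected_paths : ∀ P : C, isPath M P → IsConnectedObj.{w} M P
  pathGenerated : ∀ a : C, IsPathGenerated M a
  essentiallySmall_paths : EssentiallySmall.{w} (isPath M).FullSubcategory

variable {E : Type u'} [Category.{v'} E]

/-- A finitely accessible adjunction: an adjunction between locally finitely presentable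
categories whose right adjoint preserves filtered colimits. -/
structure IsFinitelyAccessibleAdjunction {L : C ⥤ E} {R : E ⥤ C} (_adj : L ⊣ R) : Prop where
  lfp_left : IsLocallyFinitelyPresentable.{w} C
  lfp_right : IsLocallyFinitelyPresentable.{w} E
  finitary : PreservesFilteredColimitsOfSize.{w, w} R

/-- A finitely accessible arboreal adjunction. -/
structure IsFinitelyAccessibleArborealAdjunction {L : C ⥤ E} {R : E ⥤ C} (adj : L ⊣ R) :
    Prop where
  arboreal : IsArborealCategory.{w} Q M
  finitelyAccessible : IsFinitelyAccessibleAdjunction.{w} adj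

end Abstract

/-! ### Structures and cartesian theories (one-sorted signatures) -/

section Structures

variable (σ : FirstOrder.Language.{0, 0})

/-- `σ`-structures (possibly empty). -/
structure Str : Type (w + 1) where
  carrier : Type w
  [str : σ.Structure carrier]

attribute [instance] Str.str

/-- The category of `σ`-structures and homomorphisms. -/
instance : Category (Str.{w} σ) where
  Hom A B := FirstOrder.Language.Hom σ A.carrier B.carrier
  id A := FirstOrder.Language.Hom.id σ A.carrier
  comp f g := FirstOrder.Language.Hom.comp g f

variable {σ}

/-- The underlying function of a morphism of structures. -/
def Str.toFun {A B : Str.{w} σ} (f : A ⟶ B) : A.carrier → B.carrier :=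
  (show FirstOrder.Language.Hom σ A.carrier B.carrier from f).toFun

/-- Embeddings of structures: injective homomorphisms that reflect all relations. -/
def IsStrEmbedding {A B : Str.{w} σ} (f : A ⟶ B) : Prop :=
  Function.Injective (Str.toFun f) ∧
    ∀ (n : ℕ) (r : σ.Relations n) (x : Fin n → A.carrier),
      FirstOrder.Language.Structure.RelMap r (Str.toFun f ∘ x) →
        FirstOrder.Language.Structure.RelMap r x

variable (σ)

/-- A sequent `hyp ⊢ concl` in the context `x₀, …, xₙ₋₁`. -/
structure Sequent where
  n : ℕ
  hyp : σ.BoundedFormula Empty n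
  concl : σ.BoundedFormula Empty n

variable {σ}

/-- Validity of a sequent in a structure. -/
def Sequent.Valid (s : Sequent σ) (A : Str.{w} σ) : Prop :=
  ∀ x : Fin s.n → A.carrier, s.hyp.Realize Empty.elim x → s.concl.Realize Empty.elim x

/-- The models of a set of sequents. -/
def isModel (T : Set (Sequent σ)) : ObjectProperty (Str.{w} σ) := fun A => ∀ s ∈ T, s.Valid A

/-- Horn formulae: finite conjunctions of atomic formulae. -/
inductive IsHornFormula : ∀ {n : ℕ}, σ.BoundedFormula Empty n → Prop
  | top {n : ℕ} : IsHornFormula (⊤ : σ.BoundedFormula Empty n)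
  | atomic {n : ℕ} {φ : σ.BoundedFormula Empty n} : φ.IsAtomic → IsHornFormula φ
  | inf {n : ℕ} {φ ψ : σ.BoundedFormula Empty n} :
      IsHornFormula φ → IsHornFormula ψ → IsHornFormula (φ ⊓ ψ)

/-- Horn theories. -/
def IsHornTheory (T : Set (Sequent σ)) : Prop :=
  ∀ s ∈ T, IsHornFormula s.hyp ∧ IsHornFormula s.concl

/-- Formulae which are cartesian over `T`: built from atomic formulae by finite conjunctions
and existential quantifications `∃ y, φ` where `y` is unique modulo `T`. Provable uniqueness is
expressed as validity in all models. -/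
inductive IsCartesianFormula (T : Set (Sequent σ)) :
    ∀ {n : ℕ}, σ.BoundedFormula Empty n → Prop
  | top {n : ℕ} : IsCartesianFormula T (⊤ : σ.BoundedFormula Empty n)
  | atomic {n : ℕ} {φ : σ.BoundedFormula Empty n} : φ.IsAtomic → IsCartesianFormula T φ
  | inf {n : ℕ} {φ ψ : σ.BoundedFormula Empty n} :
      IsCartesianFormula T φ → IsCartesianFormula T ψ → IsCartesianFormula T (φ ⊓ ψ)
  | ex {n : ℕ} {φ : σ.BoundedFormula Empty (n + 1)} :
      IsCartesianFormula T φ →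
      (∀ A : Str.{0} σ, isModel T A → ∀ (x : Fin n → A.carrier) (a b : A.carrier),
        φ.Realize Empty.elim (Fin.snoc x a) → φ.Realize Empty.elim (Fin.snoc x b) → a = b) →
      IsCartesianFormula T φ.ex

/-- Cartesian theories: for some well-founded relation on sequents, every axiom is built from
formulae which are cartesian over the set of the axioms preceding it. -/
def IsCartesianTheory (T : Set (Sequent σ)) : Prop :=
  ∃ r : Sequent σ → Sequent σ → Prop, WellFounded r ∧ ∀ s ∈ T,
    IsCartesianFormula {t ∈ T | r t s} s.hyp ∧ IsCartesianFormula {t ∈ T | r t s} s.concl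

variable {C : Type u} [Category.{v} C] (M : MorphismProperty C)
  (D : ObjectProperty (Str.{w} σ)) {L : C ⥤ D.FullSubcategory} {R : D.FullSubcategory ⥤ C}

/-- An adjunction between `C` (with embeddings `M`) and a full subcategory `D` of the category
of `σ`-structures detects path embeddings in `σ`. -/
structure DetectsPathEmbeddings (_adj : L ⊣ R) : Prop where
  cartesian : ∃ T : Set (Sequent σ), IsCartesianTheory T ∧
    ∀ A : Str.{w} σ, D A ↔ isModel T A
  finitelyPresentable_paths : ∀ P : C, isPath M P → IsFinitelyPresentable.{w} P
  detects : ∀ {P a : C} (f : P ⟶ a), isPath M P → (M f ↔ IsStrEmbedding (L.map f).hom)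

/-- The factorisation property: the adjunction is, up to natural isomorphism, the composite of
a finitely accessible adjunction `L' ⊣ R'` between `C` and the category of all `σ`-structures
with the reflection `F` of `σ`-structures into `D`. (An isomorphism of the left adjoints
determines one of the right adjoints.) -/
def FactorisationProperty (_adj : L ⊣ R) : Prop :=
  ∃ (F : Str.{w} σ ⥤ D.FullSubcategory) (_ : F ⊣ D.ι)
    (L' : C ⥤ Str.{w} σ) (R' : Str.{w} σ ⥤ C) (adj' : L' ⊣ R'),
    IsFinitelyAccessibleAdjunction.{w} adj' ∧ Nonempty (L' ⋙ F ≅ L)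

end Structures

/-! ### Directed graphs -/

/-- Directed graphs, possibly with self-loops: structures with one binary relation. -/
abbrev Gph : Type (w + 1) := Str.{w} FirstOrder.Language.graph

namespace Gph

/-- The edge relation. -/
def E (G : Gph.{w}) (x y : G.carrier) : Prop :=
  FirstOrder.Language.Structure.RelMap FirstOrder.Language.adj ![x, y]

/-- The graph with given vertices and edges. -/
def mk (V : Type w) (e : V → V → Prop) : Gph.{w} :=
  { carrier := V
    str :=
      { funMap := fun f => f.elim
        RelMap := fun r => match r with
          | .adj => fun x => e (x 0) (x 1) } }

theorem mk_E (V : Type w) (e : V → V → Prop) (x y : V) : (mk V e).E x y ↔ e x y := Iff.rfl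

theorem map_E {G H : Gph.{w}} (f : G ⟶ H) {x y : G.carrier} (h : G.E x y) :
    H.E (Str.toFun f x) (Str.toFun f y) := by
  have := FirstOrder.Language.Hom.map_rel
    (show FirstOrder.Language.Hom FirstOrder.Language.graph G.carrier H.carrier from f)
    FirstOrder.Language.adj ![x, y] h
  have e : Str.toFun f ∘ ![x, y] = ![Str.toFun f x, Str.toFun f y] := by
    funext i; fin_cases i <;> rfl
  unfold E
  rw [← e]
  exact this

/-- A graph homomorphism from an edge-preserving function. -/
def homMk {G H : Gph.{w}} (f : G.carrier → H.carrier)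
    (hf : ∀ x y, G.E x y → H.E (f x) (f y)) : G ⟶ H :=
  show FirstOrder.Language.Hom FirstOrder.Language.graph G.carrier H.carrier from
  { toFun := f
    map_fun' := fun c => c.elim
    map_rel' := fun r x h => by
      cases r
      have e₁ : x = ![x 0, x 1] := by funext i; fin_cases i <;> rfl
      have e₂ : f ∘ x = ![f (x 0), f (x 1)] := by funext i; fin_cases i <;> rfl
      rw [e₂]
      rw [e₁] at h
      exact hf _ _ h }

theorem hom_ext {G H : Gph.{w}} {f g : G ⟶ H} (h : ∀ x, Str.toFun f x = Str.toFun g x) :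
    f = g :=
  FirstOrder.Language.Hom.ext h

end Gph

/-- Deterministic graphs: every vertex has at most one outgoing edge. -/
def isDeterministicGraph : ObjectProperty Gph.{w} := fun G =>
  ∀ x y z : G.carrier, G.E x y → G.E x z → y = z

/-- The category of deterministic graphs. -/
abbrev DetGph : Type (w + 1) := isDeterministicGraph.{w}.FullSubcategory

/-- The full embedding of deterministic graphs into graphs. -/
abbrev detInclusion : DetGph.{w} ⥤ Gph.{w} := isDeterministicGraph.{w}.ι

/-- The sequent `E(x₀, x₁) ∧ E(x₀, x₂) ⊢ x₁ = x₂`. -/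
def detSequent : Sequent FirstOrder.Language.graph where
  n := 3
  hyp :=
    FirstOrder.Language.Relations.boundedFormula₂ FirstOrder.Language.adj
        (FirstOrder.Language.Term.var (Sum.inr 0)) (FirstOrder.Language.Term.var (Sum.inr 1)) ⊓
      FirstOrder.Language.Relations.boundedFormula₂ FirstOrder.Language.adj
        (FirstOrder.Language.Term.var (Sum.inr 0)) (FirstOrder.Language.Term.var (Sum.inr 2))
  concl :=
    FirstOrder.Language.Term.bdEqual
      (FirstOrder.Language.Term.var (Sum.inr 1)) (FirstOrder.Language.Term.var (Sum.inr 2))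

/-- The theory of deterministic graphs. -/
def detTheory : Set (Sequent FirstOrder.Language.graph) := {detSequent}

/-! ### The reflection of graphs into deterministic graphs -/

/-- The least equivalence relation on the vertices of `G` such that targets of edges with
equivalent sources are equivalent. -/
inductive DetRel (G : Gph.{w}) : G.carrier → G.carrier → Prop
  | refl (x) : DetRel G x x
  | symm {x y} : DetRel G x y → DetRel G y x
  | trans {x y z} : DetRel G x y → DetRel G y z → DetRel G x z
  | step {x x' y y'} : DetRel G x x' → G.E x y → G.E x' y' → DetRel G y y'

/-- `DetRel` as a setoid. -/
def detSetoid (G : Gph.{w}) : Setoid G.carrier :=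
  ⟨DetRel G, DetRel.refl, DetRel.symm, DetRel.trans⟩

theorem DetRel.map {G H : Gph.{w}} (f : G ⟶ H) {x y : G.carrier} (h : DetRel G x y) :
    DetRel H (Str.toFun f x) (Str.toFun f y) := by
  induction h with
  | refl x => exact .refl _
  | symm _ ih => exact ih.symm
  | trans _ _ ih₁ ih₂ => exact ih₁.trans ih₂
  | step _ h₁ h₂ ih => exact .step ih (Gph.map_E f h₁) (Gph.map_E f h₂)

/-- The quotient graph of `G` by `DetRel G`: there is an edge between two classes iff there is
an edge between some representatives. -/
def detQuotient (G : Gph.{w}) : Gph.{w} :=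
  Gph.mk (Quotient (detSetoid G)) fun a b =>
    ∃ x y : G.carrier, Quotient.mk (detSetoid G) x = a ∧ Quotient.mk (detSetoid G) y = b ∧ G.E x y

theorem isDeterministicGraph_detQuotient (G : Gph.{w}) :
    isDeterministicGraph (detQuotient G) := by
  rintro a b c ⟨x, y, rfl, rfl, h⟩ ⟨x', y', hx, rfl, h'⟩
  exact Quotient.sound (s := detSetoid G) (DetRel.step (Quotient.exact hx).symm h h')

/-- The functor `F` from graphs to deterministic graphs. -/
def detReflection : Gph.{w} ⥤ DetGph.{w} where
  obj G := ⟨detQuotient G, isDeterministicGraph_detQuotient G⟩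
  map {G H} f := ObjectProperty.homMk (Gph.homMk (G := detQuotient G) (H := detQuotient H)
    (Quotient.map (sa := detSetoid G) (sb := detSetoid H) (Str.toFun f) fun _ _ h => h.map f)
    (by
      rintro _ _ ⟨x, y, rfl, rfl, h⟩
      exact ⟨_, _, rfl, rfl, Gph.map_E f h⟩))
  map_id G := by
    apply ObjectProperty.hom_ext
    apply Gph.hom_ext
    rintro ⟨x⟩
    rfl
  map_comp f g := by
    apply ObjectProperty.hom_ext
    apply Gph.hom_ext
    rintro ⟨x⟩
    rfl

/-! ### Forests -/

/-- Forests: posets in which the elements below any given one form a finite chain. -/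
structure Forest : Type (w + 1) where
  carrier : Type w
  [order : PartialOrder carrier]
  finite_Iic : ∀ x : carrier, (Set.Iic x).Finite
  isChain_Iic : ∀ x : carrier, IsChain (· ≤ ·) (Set.Iic x)

attribute [instance] Forest.order

/-- Forest morphisms: functions preserving roots and the covering relation. -/
@[ext]
structure Forest.Hom (X Y : Forest.{w}) : Type w where
  toFun : X.carrier → Y.carrier
  map_isMin : ∀ x, IsMin x → IsMin (toFun x)
  map_covBy : ∀ x y, x ⋖ y → toFun x ⋖ toFun y

/-- The category of forests. -/
instance : Category Forest.{w} where
  Hom := Forest.Hom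
  id X := ⟨id, fun _ h => h, fun _ _ h => h⟩
  comp f g := ⟨g.toFun ∘ f.toFun, fun _ h => g.map_isMin _ (f.map_isMin _ h),
    fun _ _ h => g.map_covBy _ _ (f.map_covBy _ _ h)⟩

/-- The underlying function of a forest morphism. -/
def Forest.toFun {X Y : Forest.{w}} (f : X ⟶ Y) : X.carrier → Y.carrier :=
  Forest.Hom.toFun f

theorem Forest.hom_ext {X Y : Forest.{w}} {f g : X ⟶ Y}
    (h : ∀ x, Forest.toFun f x = Forest.toFun g x) : f = g :=
  Forest.Hom.ext (funext h)

/-- Forests whose covering relation is deterministic: every node is covered by at most one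
element. -/
def isDeterministicForest : ObjectProperty Forest.{w} := fun X =>
  ∀ x y z : X.carrier, x ⋖ y → x ⋖ z → y = z

/-- The category of forests with deterministic covering relation. -/
abbrev DetForest : Type (w + 1) := isDeterministicForest.{w}.FullSubcategory

/-- Surjective morphisms of `DetForest`. -/
def surjectiveMorphisms : MorphismProperty DetForest.{w} := fun _ _ f =>
  Function.Surjective (Forest.toFun f.hom)

/-- Injective morphisms of `DetForest`. -/
def injectiveMorphisms : MorphismProperty DetForest.{w} := fun _ _ f =>
  Function.Injective (Forest.toFun f.hom)

/-! ### The adjunction between forests and graphs, and its restriction -/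

/-- The functor sending a forest to the graph of its covering relation. -/
def coverGraph : Forest.{w} ⥤ Gph.{w} where
  obj X := Gph.mk X.carrier (· ⋖ ·)
  map {X Y} f := Gph.homMk (G := Gph.mk X.carrier (· ⋖ ·)) (H := Gph.mk Y.carrier (· ⋖ ·))
    (Forest.toFun f) (Forest.Hom.map_covBy f)
  map_id _ := rfl
  map_comp _ _ := rfl

/-- The finite (non-empty) walks in a graph. -/
def Walk (G : Gph.{w}) : Type w := {l : List G.carrier // l ≠ [] ∧ l.IsChain G.E}

namespace Walk

variable {G H : Gph.{w}}

/-- Walks are ordered by the prefix relation. -/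
instance : PartialOrder (Walk G) where
  le p q := p.1 <+: q.1
  le_refl p := List.prefix_refl _
  le_trans _ _ _ h₁ h₂ := h₁.trans h₂
  le_antisymm _ _ h₁ h₂ := Subtype.ext (h₁.eq_of_length (le_antisymm h₁.length_le h₂.length_le))

theorem le_def (p q : Walk G) : p ≤ q ↔ p.1 <+: q.1 := Iff.rfl

theorem isMin_iff (p : Walk G) : IsMin p ↔ ∃ a, p.1 = [a] := by
  constructor
  · intro h
    obtain ⟨l, hl, hc⟩ := p
    cases l with
    | nil => exact absurd rfl hl
    | cons a l =>
      have h' := h (b := ⟨[a], by simp, by simp⟩) ⟨l, rfl⟩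
      have := h'.length_le
      simp only [List.length_cons, List.length_nil] at this
      exact ⟨a, by simpa using this⟩
  · rintro ⟨a, ha⟩ q hq
    rw [le_def, ha] at *
    have h1 := hq.length_le
    have h2 := List.length_pos_of_ne_nil q.2.1
    rw [hq.eq_of_length (by simp at h1 ⊢; omega)]

theorem covBy_iff (p q : Walk G) : p ⋖ q ↔ ∃ a, q.1 = p.1 ++ [a] := by
  constructor
  · rintro ⟨hlt, hcov⟩
    obtain ⟨t, ht⟩ := hlt.le
    cases t with
    | nil => exact absurd (Subtype.ext (by simpa using ht)) hlt.ne
    | cons a t =>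
      cases t with
      | nil => exact ⟨a, ht.symm⟩
      | cons b t =>
        exfalso
        have hpre : (p.1 ++ [a]) <+: q.1 := ⟨b :: t, by simpa using ht⟩
        have hch : (p.1 ++ [a]).IsChain G.E := q.2.2.prefix hpre
        refine hcov (c := ⟨p.1 ++ [a], by simp, hch⟩) ?_ ?_
        · refine lt_of_le_of_ne ⟨[a], rfl⟩ fun h => ?_
          have := congrArg (fun r : Walk G => r.1.length) h
          simp at this
        · refine lt_of_le_of_ne hpre fun h => ?_
          have h1 := congrArg (fun r : Walk G => r.1.length) h
          have h2 := congrArg List.length ht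
          simp at h1 h2
          omega
  · rintro ⟨a, ha⟩
    refine ⟨lt_of_le_of_ne ⟨[a], ha.symm⟩ fun h => ?_, fun r h1 h2 => ?_⟩
    · have := congrArg List.length ha
      rw [h] at this
      simp at this
    · have l1 : p.1.length < r.1.length := by
        refine lt_of_le_of_ne h1.le.length_le fun h => ?_
        exact h1.ne (Subtype.ext (h1.le.eq_of_length h))
      have l2 : r.1.length < q.1.length := by
        refine lt_of_le_of_ne h2.le.length_le fun h => ?_
        exact h2.ne (Subtype.ext (h2.le.eq_of_length h))
      have := congrArg List.length ha
      simp at this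
      omega

/-- The image of a walk under a graph homomorphism. -/
def map (f : G ⟶ H) (p : Walk G) : Walk H :=
  ⟨p.1.map (Str.toFun f), by simpa using p.2.1,
    List.isChain_map_of_isChain (Str.toFun f) (fun _ _ h => Gph.map_E f h) p.2.2⟩

end Walk

/-- The functor sending a graph to the forest of its finite walks. -/
def walkForest : Gph.{w} ⥤ Forest.{w} where
  obj G :=
    { carrier := Walk G
      finite_Iic := fun p => by
        refine Set.Finite.of_finite_image (f := fun q : Walk G => q.1) ?_
          Subtype.val_injective.injOn
        refine (List.finite_toSet p.1.inits).subset ?_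
        rintro _ ⟨q, hq, rfl⟩
        exact (List.mem_inits _ _).2 hq
      isChain_Iic := fun p q hq r hr _ => List.prefix_or_prefix_of_prefix hq hr }
  map {G H} f :=
    { toFun := Walk.map f
      map_isMin := fun p hp => by
        obtain ⟨a, ha⟩ := (Walk.isMin_iff p).1 hp
        exact (Walk.isMin_iff _).2 ⟨Str.toFun f a, by simp [Walk.map, ha]⟩
      map_covBy := fun p q hpq => by
        obtain ⟨a, ha⟩ := (Walk.covBy_iff p q).1 hpq
        exact (Walk.covBy_iff _ _).2 ⟨Str.toFun f a, by simp [Walk.map, ha]⟩ }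
  map_id G := Forest.hom_ext fun (p : Walk G) =>
    show Walk.map (𝟙 G) p = p from Subtype.ext (List.map_id p.1)
  map_comp {G H K} f g := Forest.hom_ext fun (p : Walk G) =>
    show Walk.map (f ≫ g) p = Walk.map g (Walk.map f p) from
      Subtype.ext (List.map_map (l := p.1) (f := Str.toFun f) (g := Str.toFun g)).symm

theorem isDeterministicGraph_coverGraph (X : DetForest.{w}) :
    isDeterministicGraph (coverGraph.obj X.obj) := X.property

theorem isDeterministicForest_walkForest (G : DetGph.{w}) :
    isDeterministicForest (walkForest.obj G.obj) := by
  intro p q r hq hr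
  obtain ⟨a, ha⟩ := (Walk.covBy_iff (G := G.obj) p q).1 hq
  obtain ⟨b, hb⟩ := (Walk.covBy_iff (G := G.obj) p r).1 hr
  obtain ⟨c, hc⟩ : ∃ c, c ∈ p.1.getLast? := by
    cases h : p.1.getLast? with
    | none => exact absurd (List.getLast?_eq_none_iff.1 h) p.2.1
    | some c => exact ⟨c, rfl⟩
  have h1 := q.2.2
  have h2 := r.2.2
  rw [ha, List.isChain_append] at h1
  rw [hb, List.isChain_append] at h2
  have e : a = b := G.property c a b (h1.2.2 c hc a (by simp)) (h2.2.2 c hc b (by simp))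
  exact Subtype.ext (by rw [ha, hb, e])

/-- The restriction `L^D` of `coverGraph`. -/
def detCoverGraph : DetForest.{w} ⥤ DetGph.{w} :=
  isDeterministicGraph.lift (isDeterministicForest.ι ⋙ coverGraph)
    isDeterministicGraph_coverGraph

/-- The restriction `R^D` of `walkForest`. -/
def detWalkForest : DetGph.{w} ⥤ DetForest.{w} :=
  isDeterministicForest.lift (isDeterministicGraph.ι ⋙ walkForest)
    isDeterministicForest_walkForest

end Arboreal

open Arboreal

/-!
Every node of a forest is described by its height and its ancestors. The functor `Forest.levels`
sending a forest to its sets of nodes of given height, with the ancestor maps between them, is an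
equivalence from forests to presheaves on `ℕ`. Hence forests form a locally finitely presentable
category, and filtered colimits of forests are computed on nodes
(`Forest.exists_of_isColimit`, `Forest.exists_eq_of_isColimit`, `Forest.nonempty_isColimit`).
Colimits of graphs are computed on vertices, an edge of the colimit being the image of an edge of
the diagram; the graphs with one vertex, and with one edge, form a strong generator of finitely
presentable objects. Deterministic forests and deterministic graphs are closed under filtered
colimits and reflective (merge the branches with the same root, respectively divide by `DetRel`), so
they inherit local finite presentability.

A morphism from a forest to the forest of walks of a graph is determined by the last vertices of the
walks, and these form a morphism from the covering graph: this is the adjunction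
`Forest.walkAdjunction`. A walk in a filtered colimit of graphs lifts to a walk at some stage, so
the right adjoint is finitary. Everything restricts to the deterministic objects.

In a deterministic forest the images of morphisms are lower sets, a morphism factors through an
injective one as soon as its image does (`DetForest.exists_lift`), and the paths are the finite
chains (`DetForest.isPath_iff`). A morphism out of a chain is injective because it preserves
heights. The axioms of arboreal categories follow: a map from a path into a colimit lands in the
image of the component which contains the image of the top element, and a forest is glued from the
chains `below x`.

For the failure of the factorisation property, let `ω` be the infinite branch, and let `P` be its
root. Since every node of a deterministic forest is covered by at most one element, `P ⟶ ω` is an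
epimorphism. Suppose that the adjunction is the composite of a finitely accessible `L ⊣ R` with
the reflection `F` of graphs into deterministic graphs. As `P` is finitely presentable, `L P` has
finitely many vertices; as `L P ⟶ L ω` is an epimorphism of graphs, it is surjective on vertices, so
that `L ω` is finite as well. Then so is `F (L ω)`, a quotient of `L ω`, but it should be the
infinite covering graph of `ω`.
-/

namespace Arboreal

/-! ### Heights and ancestors in forests -/

namespace Forest

section Height

variable {X : Forest.{w}}

theorem finite_Iio (x : X.carrier) : (Set.Iio x).Finite :=
  (X.finite_Iic x).subset Set.Iio_subset_Iic_self

theorem le_total_of_le {x y z : X.carrier} (hx : x ≤ z) (hy : y ≤ z) : x ≤ y ∨ y ≤ x :=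
  (X.isChain_Iic z).total hx hy

theorem le_of_lt_covBy {x y z : X.carrier} (h : x ⋖ y) (hz : z < y) : z ≤ x := by
  rcases le_total_of_le hz.le h.le with h' | h'
  · exact h'
  · rcases h'.eq_or_lt with h' | h'
    · exact h'.ge
    · exact absurd hz (h.2 h')

theorem exists_covBy_of_not_isMin {x : X.carrier} (hx : ¬ IsMin x) : ∃ y, y ⋖ x := by
  obtain ⟨y, hy⟩ := not_isMin_iff.1 hx
  obtain ⟨m, hm⟩ := (finite_Iio x).exists_maximal ⟨y, hy⟩
  exact ⟨m, hm.prop, fun c h₁ h₂ => absurd (hm.le_of_ge h₂ h₁.le) h₁.not_ge⟩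

/-- The height of a node: the number of nodes strictly below it. -/
noncomputable def ht (x : X.carrier) : ℕ := (Set.Iio x).ncard

theorem ht_strictMono : StrictMono (ht (X := X)) := fun _ y h =>
  Set.ncard_lt_ncard (Set.Iio_ssubset_Iio h) (finite_Iio y)

theorem ht_covBy {x y : X.carrier} (h : x ⋖ y) : ht y = ht x + 1 := by
  have : Set.Iio y = insert x (Set.Iio x) := by
    ext z
    simp only [Set.mem_Iio, Set.mem_insert_iff]
    constructor
    · exact fun hz => (le_of_lt_covBy h hz).eq_or_lt
    · rintro (rfl | hz)
      exacts [h.lt, hz.trans h.lt]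
  rw [ht, this, Set.ncard_insert_of_notMem (by simp) (finite_Iio x), ht]

theorem ht_eq_zero_iff {x : X.carrier} : ht x = 0 ↔ IsMin x := by
  rw [ht, Set.ncard_eq_zero (finite_Iio x), Set.Iio_eq_empty_iff]

/-- Induction along the covering relation of a forest. -/
theorem induction {p : X.carrier → Prop} (root : ∀ x, IsMin x → p x)
    (covBy : ∀ x y, x ⋖ y → p x → p y) (x : X.carrier) : p x := by
  induction h : ht x generalizing x with
  | zero => exact root x (ht_eq_zero_iff.1 h)
  | succ n ih =>
    have hx : ¬ IsMin x := fun h' => by rw [ht_eq_zero_iff.2 h'] at h; omega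
    obtain ⟨y, hy⟩ := exists_covBy_of_not_isMin hx
    have := ht_covBy hy
    exact covBy y x hy (ih y (by omega))

/-- The height is the only function vanishing at the roots and increasing by one along the
covering relation. -/
theorem ht_unique (h : X.carrier → ℕ) (h₀ : ∀ x, IsMin x → h x = 0)
    (h₁ : ∀ x y, x ⋖ y → h y = h x + 1) (x : X.carrier) : ht x = h x := by
  induction x using induction with
  | root x hx => rw [h₀ x hx, ht_eq_zero_iff.2 hx]
  | covBy x y hxy ih => rw [ht_covBy hxy, h₁ x y hxy, ih]

theorem eq_of_le_of_ht_le {x y : X.carrier} (h : x ≤ y) (hh : ht y ≤ ht x) : x = y := by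
  by_contra hne
  exact absurd (ht_strictMono (lt_of_le_of_ne h hne)) (by omega)

theorem covBy_iff {x y : X.carrier} : x ⋖ y ↔ x ≤ y ∧ ht y = ht x + 1 := by
  refine ⟨fun h => ⟨h.le, ht_covBy h⟩, fun ⟨h₁, h₂⟩ => ⟨?_, fun z hz hz' => ?_⟩⟩
  · refine lt_of_le_of_ne h₁ ?_
    rintro rfl
    omega
  · have := ht_strictMono hz
    have := ht_strictMono hz'
    omega

theorem eq_of_le_of_ht_eq {x y z : X.carrier} (hx : x ≤ z) (hy : y ≤ z) (h : ht x = ht y) :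
    x = y := by
  rcases le_total_of_le hx hy with h' | h'
  · exact eq_of_le_of_ht_le h' h.ge
  · exact (eq_of_le_of_ht_le h' h.le).symm

theorem exists_le_ht_eq (x : X.carrier) {n : ℕ} (hn : n ≤ ht x) : ∃ y, y ≤ x ∧ ht y = n := by
  induction x using induction with
  | root x hx =>
    rw [ht_eq_zero_iff.2 hx] at hn
    exact ⟨x, le_rfl, by rw [ht_eq_zero_iff.2 hx]; omega⟩
  | covBy x y hxy ih =>
    rcases hn.eq_or_lt with h | h
    · exact ⟨y, le_rfl, h.symm⟩
    · rw [ht_covBy hxy] at h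
      obtain ⟨z, hz, hz'⟩ := ih (by omega)
      exact ⟨z, hz.trans hxy.le, hz'⟩

open Classical in
/-- The ancestor of `x` at height `n`; by convention it is `x` itself if `n` exceeds the height
of `x`. -/
noncomputable def anc (x : X.carrier) (n : ℕ) : X.carrier :=
  if h : n ≤ ht x then (exists_le_ht_eq x h).choose else x

theorem anc_le (x : X.carrier) (n : ℕ) : anc x n ≤ x := by
  unfold anc
  split_ifs with h
  · exact (exists_le_ht_eq x h).choose_spec.1
  · exact le_rfl

theorem ht_anc (x : X.carrier) {n : ℕ} (hn : n ≤ ht x) : ht (anc x n) = n := by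
  rw [anc, dif_pos hn]
  exact (exists_le_ht_eq x hn).choose_spec.2

theorem anc_eq {x y : X.carrier} (h : y ≤ x) {n : ℕ} (hn : ht y = n) : anc x n = y := by
  have : n ≤ ht x := hn ▸ ht_strictMono.monotone h
  exact eq_of_le_of_ht_eq (anc_le x n) h (by rw [ht_anc x this, hn])

theorem anc_eq_of_le {x y : X.carrier} (h : x ≤ y) {n : ℕ} (hn : n ≤ ht x) :
    anc y n = anc x n :=
  anc_eq ((anc_le x n).trans h) (ht_anc x hn)

end Height

section Hom

variable {X Y Z : Forest.{w}}

@[simp] theorem comp_toFun (f : X ⟶ Y) (g : Y ⟶ Z) (x : X.carrier) :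
    toFun (f ≫ g) x = toFun g (toFun f x) := rfl

theorem isMin_map (f : X ⟶ Y) {x : X.carrier} (h : IsMin x) : IsMin (toFun f x) :=
  Hom.map_isMin f x h

theorem covBy_map (f : X ⟶ Y) {x y : X.carrier} (h : x ⋖ y) : toFun f x ⋖ toFun f y :=
  Hom.map_covBy f x y h

@[simp] theorem ht_map (f : X ⟶ Y) (x : X.carrier) : ht (toFun f x) = ht x :=
  (ht_unique (fun x => ht (toFun f x)) (fun _ h => ht_eq_zero_iff.2 (isMin_map f h))
    (fun _ _ h => ht_covBy (covBy_map f h)) x).symm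

theorem map_le (f : X ⟶ Y) {x y : X.carrier} (h : x ≤ y) : toFun f x ≤ toFun f y := by
  induction y using induction with
  | root y hy => rw [hy.eq_of_le h]
  | covBy y z hyz ih =>
    rcases h.eq_or_lt with rfl | h
    · exact le_rfl
    · exact (ih (le_of_lt_covBy hyz h)).trans (covBy_map f hyz).le

theorem map_anc (f : X ⟶ Y) (x : X.carrier) {n : ℕ} (hn : n ≤ ht x) :
    toFun f (anc x n) = anc (toFun f x) n :=
  (anc_eq (map_le f (anc_le x n)) (by rw [ht_map, ht_anc x hn])).symm

/-- Forest morphisms are open: everything below a value is a value. -/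
theorem exists_le_map_eq (f : X ⟶ Y) {x : X.carrier} {y : Y.carrier} (h : y ≤ toFun f x) :
    ∃ z, z ≤ x ∧ toFun f z = y := by
  have hn : ht y ≤ ht x := by simpa using ht_strictMono.monotone h
  exact ⟨anc x (ht y), anc_le _ _, by rw [map_anc f x hn]; exact anc_eq h rfl⟩

/-- A forest morphism from a monotone function preserving heights. -/
def homMk (f : X.carrier → Y.carrier) (hf : Monotone f) (h : ∀ x, ht (f x) = ht x) : X ⟶ Y where
  toFun := f
  map_isMin x hx := by rw [← ht_eq_zero_iff, h, ht_eq_zero_iff]; exact hx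
  map_covBy x y hxy := by
    rw [covBy_iff] at hxy ⊢
    exact ⟨hf hxy.1, by rw [h, h, hxy.2]⟩

/-- A morphism whose values are values of an injective morphism `m` factors through `m`. -/
theorem exists_lift (f : Z ⟶ X) (m : Y ⟶ X) (hm : Function.Injective (toFun m))
    (h : ∀ z, ∃ y, toFun m y = toFun f z) : ∃ l : Z ⟶ Y, l ≫ m = f := by
  choose l hl using h
  refine ⟨homMk l (fun z z' hz => ?_) (fun z => ?_), hom_ext hl⟩
  · have := map_le f hz
    rw [← hl z'] at this
    obtain ⟨y, hy, hy'⟩ := exists_le_map_eq m this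
    rw [← hl z] at hy'
    rwa [← hm hy']
  · rw [← ht_map m, hl, ht_map]

/-- The restriction of a forest to a lower set. -/
def sub (X : Forest.{w}) (S : Set X.carrier) (_hS : IsLowerSet S) : Forest.{w} where
  carrier := S
  finite_Iic x := Set.Finite.of_finite_image
    ((X.finite_Iic x.1).subset (by rintro _ ⟨y, hy, rfl⟩; exact hy)) Subtype.val_injective.injOn
  isChain_Iic x y hy z hz _ := le_total_of_le (X := X) (z := x.1) hy hz

/-- The inclusion of a lower set. -/
def subι (X : Forest.{w}) (S : Set X.carrier) (hS : IsLowerSet S) : X.sub S hS ⟶ X where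
  toFun x := x.1
  map_isMin _ hx _ hy := hx (b := ⟨_, hS hy (Subtype.prop _)⟩) hy
  map_covBy _ y hxy := ⟨hxy.1, fun z hz hz' => hxy.2 (c := ⟨z, hS hz'.le y.2⟩) hz hz'⟩

theorem subι_injective (S : Set X.carrier) (hS : IsLowerSet S) :
    Function.Injective (toFun (X.subι S hS)) := Subtype.val_injective

theorem isDeterministicForest_of_injective (f : X ⟶ Y) (hf : Function.Injective (toFun f))
    (hY : isDeterministicForest Y) : isDeterministicForest X := fun _ _ _ h h' =>
  hf (hY _ _ _ (covBy_map f h) (covBy_map f h'))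

end Hom

section Deterministic

variable {X Y : Forest.{w}}

theorem eq_of_ge_of_ht_eq (hX : isDeterministicForest X) {x y z : X.carrier} (hy : x ≤ y)
    (hz : x ≤ z) (h : ht y = ht z) : y = z := by
  induction y using induction generalizing z with
  | root y hy' =>
    rw [hy'.eq_of_le hy] at hz
    exact eq_of_le_of_ht_le hz h.ge
  | covBy u y hu ih =>
    rcases hy.eq_or_lt with rfl | hy
    · exact eq_of_le_of_ht_le hz h.ge
    · have hy' := ht_strictMono hy
      have hz' : ¬ IsMin z := fun h' => by rw [ht_eq_zero_iff.2 h'] at h; omega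
      obtain ⟨v, hv⟩ := exists_covBy_of_not_isMin hz'
      have huv := h
      rw [ht_covBy hu, ht_covBy hv] at huv
      have hxz : x < z := lt_of_le_of_ne hz (by rintro rfl; omega)
      obtain rfl := ih (le_of_lt_covBy hu hy) (le_of_lt_covBy hv hxz) (by omega)
      exact hX _ _ _ hu hv

theorem le_of_anc_zero_eq (hX : isDeterministicForest X) {x y : X.carrier}
    (h : anc x 0 = anc y 0) (hh : ht x ≤ ht y) : x ≤ y := by
  have h₁ : anc y 0 ≤ anc y (ht x) := by
    rw [anc_eq_of_le (anc_le y (ht x)) (Nat.zero_le _)]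
    exact (anc_le _ _)
  have : x = anc y (ht x) :=
    eq_of_ge_of_ht_eq hX (anc_le x 0) (h ▸ h₁) (by rw [ht_anc y hh])
  rw [this]
  exact anc_le _ _

/-- A forest is deterministic iff comparability is an equivalence relation, whose classes are
the branches. -/
theorem isDeterministicForest_iff : isDeterministicForest X ↔
    ∃ (I : Type w) (branch : X.carrier → I), ∀ x y, branch x = branch y ↔ x ≤ y ∨ y ≤ x := by
  constructor
  · intro hX
    refine ⟨X.carrier, fun x => anc x 0, fun x y => ⟨fun h => ?_, ?_⟩⟩
    · rcases le_total (ht x) (ht y) with hh | hh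
      · exact .inl (le_of_anc_zero_eq hX h hh)
      · exact .inr (le_of_anc_zero_eq hX h.symm hh)
    · rintro (h | h)
      · exact (anc_eq_of_le h (Nat.zero_le _)).symm
      · exact anc_eq_of_le h (Nat.zero_le _)
  · rintro ⟨I, b, hb⟩ x y z hy hz
    have : b y = b z := ((hb x y).2 (.inl hy.le)).symm.trans ((hb x z).2 (.inl hz.le))
    rcases (hb y z).1 this with h | h
    · exact eq_of_le_of_ht_le h (by rw [ht_covBy hy, ht_covBy hz])
    · exact (eq_of_le_of_ht_le h (by rw [ht_covBy hy, ht_covBy hz])).symm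

/-- Two morphisms into a deterministic forest which agree at `x` agree above `x`. -/
theorem map_eq_of_le (hY : isDeterministicForest Y) (f g : X ⟶ Y) {x y : X.carrier}
    (h : toFun f x = toFun g x) (hxy : x ≤ y) : toFun f y = toFun g y :=
  eq_of_ge_of_ht_eq hY (map_le f hxy) (h ▸ map_le g hxy) (by simp)

end Deterministic

end Forest

/-! ### Forests as presheaves on the natural numbers -/

namespace Forest

open Opposite

/-- The presheaf on `ℕ` of a forest: its value at `n` is the set of nodes of height `n`, and the
restriction maps send a node to its ancestors. -/
noncomputable def levels : Forest.{w} ⥤ (ULift.{w} ℕ)ᵒᵖ ⥤ Type w where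
  obj X :=
    { obj n := {x : X.carrier // ht x = n.unop.down}
      map {m n} f := ↾fun x => ⟨anc x.1 n.unop.down, ht_anc _ (by
        have h : n.unop ≤ m.unop := leOfHom f.unop
        rw [x.2]
        exact h)⟩
      map_id n := ConcreteCategory.hom_ext _ _ fun x => Subtype.ext (anc_eq le_rfl x.2)
      map_comp {k m n} f g := ConcreteCategory.hom_ext _ _ fun x => by
        have h : n.unop ≤ m.unop := leOfHom g.unop
        have h' : m.unop ≤ k.unop := leOfHom f.unop
        have h'' : m.unop.down ≤ ht x.1 := by rw [x.2]; exact h'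
        have e := ht_anc _ h''
        exact Subtype.ext (anc_eq_of_le (anc_le x.1 m.unop.down) (e.symm ▸ h)) }
  map {X Y} f :=
    { app n := ↾fun x => ⟨toFun f x.1, by rw [ht_map, x.2]⟩
      naturality m n g := ConcreteCategory.hom_ext _ _ fun x => by
        have h : n.unop ≤ m.unop := leOfHom g.unop
        refine Subtype.ext (map_anc f x.1 ?_)
        rw [x.2]
        exact h }

instance : levels.{w}.Faithful where
  map_injective {X Y} f g h := hom_ext fun x => by
    have := ConcreteCategory.congr_hom (congrArg (fun t => t.app (op ⟨ht x⟩)) h) ⟨x, rfl⟩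
    exact congrArg Subtype.val this

instance : levels.{w}.Full where
  map_surjective {X Y} η := by
    have key : ∀ (n : ℕ) (x : X.carrier) (h : ht x = n),
        (η.app (op ⟨n⟩) ⟨x, h⟩).1 = (η.app (op ⟨ht x⟩) ⟨x, rfl⟩).1 := by
      rintro _ x rfl
      rfl
    refine ⟨homMk (fun x => (η.app (op ⟨ht x⟩) ⟨x, rfl⟩).1) (fun x y h => ?_)
      (fun x => (η.app (op ⟨ht x⟩) ⟨x, rfl⟩).2), ?_⟩
    · let g : (⟨ht x⟩ : ULift.{w} ℕ) ⟶ ⟨ht y⟩ := homOfLE (ht_strictMono.monotone h)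
      have := congrArg Subtype.val
        (ConcreteCategory.congr_hom (η.naturality g.op) ⟨y, rfl⟩)
      have hx : ((levels.obj X).map g.op ⟨y, rfl⟩) = ⟨x, rfl⟩ := Subtype.ext (anc_eq h rfl)
      change (η.app (op ⟨ht x⟩) ((levels.obj X).map g.op ⟨y, rfl⟩)).1 =
        anc (η.app (op ⟨ht y⟩) ⟨y, rfl⟩).1 (ht x) at this
      rw [hx] at this
      change (η.app (op ⟨ht x⟩) ⟨x, rfl⟩).1 ≤ _
      rw [this]
      exact anc_le _ _
    · ext n : 2
      exact ConcreteCategory.hom_ext _ _ fun x => Subtype.ext (key n.unop.down x.1 x.2).symm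

section OfPresheaf

variable (F : (ULift.{w} ℕ)ᵒᵖ ⥤ Type w)

theorem presheaf_map_self {n : ULift.{w} ℕ} (f : op n ⟶ op n) (a : F.obj (op n)) :
    F.map f a = a := by
  obtain rfl : f = 𝟙 _ := Subsingleton.elim _ _
  exact ConcreteCategory.congr_hom (F.map_id (op n)) a

theorem presheaf_map_map {k m n : ULift.{w} ℕ} (f : op n ⟶ op m) (g : op m ⟶ op k)
    (h : op n ⟶ op k) (a : F.obj (op n)) : F.map g (F.map f a) = F.map h a := by
  obtain rfl : h = f ≫ g := Subsingleton.elim _ _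
  exact (ConcreteCategory.congr_hom (F.map_comp f g) a).symm

/-- The elements of a presheaf on `ℕ`, ordered so that an element lies above its restrictions. -/
def Elements : Type w := Σ n : ULift.{w} ℕ, F.obj (op n)

instance : PartialOrder (Elements F) where
  le a b := ∃ h : a.1 ≤ b.1, F.map (homOfLE h).op b.2 = a.2
  le_refl a := ⟨le_rfl, presheaf_map_self F _ _⟩
  le_trans a b c := by
    rintro ⟨h₁, e₁⟩ ⟨h₂, e₂⟩
    refine ⟨h₁.trans h₂, ?_⟩
    rw [← e₁, ← e₂]
    exact (presheaf_map_map F _ _ _ _).symm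
  le_antisymm := by
    rintro ⟨m, a⟩ ⟨n, b⟩ ⟨h₁, e₁⟩ ⟨h₂, -⟩
    obtain rfl : m = n := le_antisymm h₁ h₂
    obtain rfl : b = a := (presheaf_map_self F _ _).symm.trans e₁
    rfl

variable {F} in
theorem Elements.le_of_le {a b c : Elements F} (ha : a ≤ c) (hb : b ≤ c)
    (h : a.1 ≤ b.1) : a ≤ b := by
  obtain ⟨h₁, e₁⟩ := ha
  obtain ⟨h₂, e₂⟩ := hb
  refine ⟨h, ?_⟩
  rw [← e₁, ← e₂]
  exact presheaf_map_map F _ _ _ _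

/-- The forest of elements of a presheaf on `ℕ`. -/
def ofPresheaf : Forest.{w} where
  carrier := Elements F
  finite_Iic a := by
    refine Set.Finite.of_finite_image (f := fun b => b.1.down)
      ((Set.finite_Iic a.1.down).subset ?_) fun b hb c hc (h : b.1.down = c.1.down) => ?_
    · rintro _ ⟨b, ⟨hb, -⟩, rfl⟩
      exact hb
    · have h' : b.1 = c.1 := ULift.ext _ _ h
      exact le_antisymm (Elements.le_of_le hb hc h'.le) (Elements.le_of_le hc hb h'.ge)
  isChain_Iic a b hb c hc _ := by
    rcases le_total b.1 c.1 with h | h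
    · exact .inl (Elements.le_of_le hb hc h)
    · exact .inr (Elements.le_of_le hc hb h)

theorem ht_ofPresheaf (a : (ofPresheaf F).carrier) : ht a = a.1.down := by
  refine ht_unique (fun a : (ofPresheaf F).carrier => a.1.down) (fun a ha => ?_)
    (fun a b h => ?_) a
  · have h0 : (⟨0⟩ : ULift.{w} ℕ) ≤ a.1 := Nat.zero_le _
    have : a ≤ ⟨⟨0⟩, F.map (homOfLE h0).op a.2⟩ := ha ⟨h0, rfl⟩
    exact Nat.le_zero.1 this.1
  · have h₀ : a.1 ≤ b.1 := h.le.1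
    have hne : a.1.down ≠ b.1.down := fun h' => by
      have h'' : b.1 ≤ a.1 := h'.ge
      exact h.lt.not_ge (Elements.le_of_le le_rfl h.le h'')
    -- Otherwise the restriction of `b` to level `a.1 + 1` lies strictly in between.
    by_contra hc
    have h₁ : a.1 ≤ ⟨a.1.down + 1⟩ := Nat.le_succ a.1.down
    have h₂ : (⟨a.1.down + 1⟩ : ULift.{w} ℕ) ≤ b.1 := lt_of_le_of_ne (α := ℕ) h₀ hne
    let c : Elements F := ⟨⟨a.1.down + 1⟩, F.map (homOfLE h₂).op b.2⟩
    have hcb : c ≤ b := ⟨h₂, rfl⟩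
    have hac : a ≤ c := Elements.le_of_le h.le hcb h₁
    refine h.2 (c := c) (lt_of_le_of_ne hac fun e => ?_) (lt_of_le_of_ne hcb fun e => ?_)
    · have := congrArg (fun t : Elements F => t.1.down) e
      simp [c] at this
    · have := congrArg (fun t : Elements F => t.1.down) e
      exact hc this.symm

instance : levels.{w}.EssSurj where
  mem_essImage F := by
    let φ (n : (ULift.{w} ℕ)ᵒᵖ) : F.obj n ⟶ (levels.obj (ofPresheaf F)).obj n :=
      ↾fun y => ⟨⟨n.unop, y⟩, ht_ofPresheaf F _⟩
    have hφ (n) : IsIso (φ n) := by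
      rw [isIso_iff_bijective]
      refine ⟨fun y y' h => ?_, ?_⟩
      · have h' : (⟨n.unop, y⟩ : Elements F) = ⟨n.unop, y'⟩ := congrArg Subtype.val h
        exact eq_of_heq (Sigma.mk.inj h').2
      · rintro ⟨⟨m, y⟩, h⟩
        obtain rfl : m = n.unop := ULift.ext _ _ ((ht_ofPresheaf F _).symm.trans h)
        exact ⟨y, rfl⟩
    refine ⟨ofPresheaf F, ⟨(NatIso.ofComponents (fun n => asIso (φ n)) ?_).symm⟩⟩
    intro m n f
    refine ConcreteCategory.hom_ext _ _ fun y => Subtype.ext ?_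
    have h : n.unop ≤ m.unop := leOfHom f.unop
    let a : Elements F := ⟨n.unop, F.map f y⟩
    let b : Elements F := ⟨m.unop, y⟩
    have h' : a ≤ b := ⟨h, rfl⟩
    exact (anc_eq (X := ofPresheaf F) h' (ht_ofPresheaf F _)).symm

end OfPresheaf

instance : levels.{w}.IsEquivalence where

attribute [local instance] Cardinal.fact_isRegular_aleph0

theorem isLocallyFinitelyPresentable : IsLocallyFinitelyPresentable.{w} Forest.{w} :=
  levels.asEquivalence.symm.isCardinalLocallyPresentable Cardinal.aleph0.{w}

end Forest

/-! ### Filtered colimits of forests -/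

namespace Forest

open Opposite

section Colimits

variable {J : Type w} [SmallCategory J] {D : J ⥤ Forest.{w}} {c : Cocone D}

theorem exists_of_isColimit (hc : IsColimit c) (x : c.pt.carrier) :
    ∃ (j : J) (y : (D.obj j).carrier), toFun (c.ι.app j) y = x := by
  obtain ⟨j, y, hy⟩ := Types.jointly_surjective_of_isColimit
    (isColimitOfPreserves (levels ⋙ (evaluation _ _).obj (op ⟨ht x⟩)) hc) ⟨x, rfl⟩
  exact ⟨j, y.1, congrArg Subtype.val hy⟩

theorem exists_eq_of_isColimit [IsFiltered J] (hc : IsColimit c) {i j : J} (x : (D.obj i).carrier)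
    (y : (D.obj j).carrier) (h : toFun (c.ι.app i) x = toFun (c.ι.app j) y) :
    ∃ (k : J) (f : i ⟶ k) (g : j ⟶ k), toFun (D.map f) x = toFun (D.map g) y := by
  have hxy : ht y = ht x := by
    rw [← ht_map (c.ι.app j) y, ← h, ht_map]
  obtain ⟨k, f, g, hk⟩ := (Types.FilteredColimit.isColimit_eq_iff _
    (isColimitOfPreserves (levels ⋙ (evaluation _ _).obj (op ⟨ht x⟩)) hc)
    (xi := ⟨x, rfl⟩) (xj := ⟨y, hxy⟩)).1 (Subtype.ext h)
  exact ⟨k, f, g, congrArg Subtype.val hk⟩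

/-- A cocone over a filtered diagram of forests is a colimit if it is one on nodes. -/
theorem nonempty_isColimit (c : Cocone D)
    (h₁ : ∀ x : c.pt.carrier, ∃ (j : J) (y : (D.obj j).carrier), toFun (c.ι.app j) y = x)
    (h₂ : ∀ (i j : J) (x : (D.obj i).carrier) (y : (D.obj j).carrier),
      toFun (c.ι.app i) x = toFun (c.ι.app j) y →
        ∃ (k : J) (f : i ⟶ k) (g : j ⟶ k), toFun (D.map f) x = toFun (D.map g) y) :
    Nonempty (IsColimit c) := by
  refine ⟨isColimitOfReflects levels (evaluationJointlyReflectsColimits _ fun n => ?_)⟩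
  refine Types.FilteredColimit.isColimitOf _ _ (fun x => ?_) (fun i j x y h => ?_)
  · obtain ⟨j, y, hy⟩ := h₁ x.1
    refine ⟨j, ⟨y, ?_⟩, Subtype.ext hy.symm⟩
    rw [← ht_map (c.ι.app j), hy, x.2]
  · obtain ⟨k, f, g, hk⟩ := h₂ i j x.1 y.1 (congrArg Subtype.val h)
    exact ⟨k, f, g, Subtype.ext hk⟩

theorem isDeterministicForest_of_isColimit [IsFiltered J] (hc : IsColimit c)
    (hD : ∀ j, isDeterministicForest (D.obj j)) : isDeterministicForest c.pt := by
  intro x y z hy hz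
  obtain ⟨i, y', rfl⟩ := exists_of_isColimit hc y
  obtain ⟨j, z', rfl⟩ := exists_of_isColimit hc z
  obtain ⟨u, hu, rfl⟩ := exists_le_map_eq _ hy.le
  obtain ⟨v, hv, hv'⟩ := exists_le_map_eq _ hz.le
  obtain ⟨k, f, g, hk⟩ := exists_eq_of_isColimit hc u v hv'.symm
  have e : toFun (D.map f) y' = toFun (D.map g) z' := by
    have h₁ := ht_covBy hy
    have h₂ := ht_covBy hz
    simp only [ht_map] at h₁ h₂
    exact eq_of_ge_of_ht_eq (hD k) (map_le _ hu) (hk ▸ map_le _ hv) (by simp; omega)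
  rw [← c.w f, ← c.w g, comp_toFun, comp_toFun, e]

end Colimits

instance (J : Type w) [SmallCategory J] [IsFiltered J] :
    isDeterministicForest.{w}.IsClosedUnderColimitsOfShape J where
  colimitsOfShape_le _ := fun ⟨p⟩ =>
    isDeterministicForest_of_isColimit p.isColimit p.prop_diag_obj

end Forest

/-! ### The reflection of forests into deterministic forests -/

namespace Forest

/-- The quotient of a forest which merges all the branches with the same root: its nodes are
represented by the pairs consisting of a root and a height that is attained above it. -/
def Merge (X : Forest.{w}) : Type w :=
  {p : X.carrier × ULift.{w} ℕ // ∃ x : X.carrier, anc x 0 = p.1 ∧ ht x = p.2.down}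

instance (X : Forest.{w}) : PartialOrder (Merge X) where
  le p q := p.1.1 = q.1.1 ∧ p.1.2 ≤ q.1.2
  le_refl p := ⟨rfl, le_rfl⟩
  le_trans p q r h h' := ⟨h.1.trans h'.1, h.2.trans h'.2⟩
  le_antisymm p q h h' := Subtype.ext (Prod.ext h.1 (le_antisymm h.2 h'.2))

/-- The forest obtained by merging the branches with the same root. -/
def merge (X : Forest.{w}) : Forest.{w} where
  carrier := Merge X
  finite_Iic p := by
    refine Set.Finite.of_finite_image (f := fun q => q.1.2.down)
      ((Set.finite_Iic p.1.2.down).subset ?_) fun q hq r hr (h : q.1.2.down = r.1.2.down) => ?_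
    · rintro _ ⟨q, ⟨-, hq⟩, rfl⟩
      exact hq
    · exact Subtype.ext (Prod.ext (hq.1.trans hr.1.symm) (ULift.ext _ _ h))
  isChain_Iic p q hq r hr _ := by
    rcases le_total q.1.2 r.1.2 with h | h
    · exact .inl ⟨hq.1.trans hr.1.symm, h⟩
    · exact .inr ⟨hr.1.trans hq.1.symm, h⟩

/-- The class of a node. -/
noncomputable def mergeMk {X : Forest.{w}} (x : X.carrier) : X.merge.carrier :=
  ⟨(anc x 0, ⟨ht x⟩), x, rfl, rfl⟩

theorem mergeMk_mono {X : Forest.{w}} : Monotone (mergeMk (X := X)) := fun _ _ h =>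
  ⟨(anc_eq_of_le h (Nat.zero_le _)).symm, ht_strictMono.monotone h⟩

theorem mergeMk_surjective {X : Forest.{w}} : Function.Surjective (mergeMk (X := X)) := by
  rintro ⟨p, x, h₁, h₂⟩
  exact ⟨x, Subtype.ext (Prod.ext h₁ (ULift.ext _ _ h₂))⟩

theorem ht_mergeMk {X : Forest.{w}} (x : X.carrier) : ht (mergeMk x) = ht x := by
  refine ht_unique (fun p : X.merge.carrier => p.1.2.down) (fun p hp => ?_) (fun p q h => ?_)
    (mergeMk x)
  · obtain ⟨x, rfl⟩ := mergeMk_surjective p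
    have : ht x ≤ ht (anc x 0) := (hp (mergeMk_mono (anc_le x 0))).2
    rw [ht_anc x (Nat.zero_le _)] at this
    exact Nat.le_zero.1 this
  · obtain ⟨x, rfl⟩ := mergeMk_surjective p
    obtain ⟨y, rfl⟩ := mergeMk_surjective q
    change ht y = ht x + 1
    obtain ⟨h₁, h₂⟩ := h.le
    change anc x 0 = anc y 0 at h₁
    change ht x ≤ ht y at h₂
    have hne : ht x ≠ ht y := fun e => h.ne (Subtype.ext (Prod.ext h₁ (ULift.ext _ _ e)))
    have hlt : ht x + 1 ≤ ht y := by omega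
    -- Otherwise the ancestor of `y` at height `ht x + 1` gives a node strictly in between.
    by_contra hc
    have hz := ht_anc y hlt
    refine h.2 (c := mergeMk (anc y (ht x + 1))) (lt_of_le_of_ne ⟨?_, ?_⟩ fun e => ?_)
      (lt_of_le_of_ne (mergeMk_mono (anc_le y _)) fun e => ?_)
    · exact h₁.trans (anc_eq_of_le (anc_le y _) (Nat.zero_le _))
    · change ht x ≤ ht (anc y (ht x + 1))
      omega
    · have : ht x = ht (anc y (ht x + 1)) := congrArg (fun p : Merge X => p.1.2.down) e
      omega
    · have : ht (anc y (ht x + 1)) = ht y := congrArg (fun p : Merge X => p.1.2.down) e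
      omega

theorem isDeterministicForest_merge (X : Forest.{w}) : isDeterministicForest X.merge := by
  intro p q r hq hr
  have h := (ht_covBy hq).trans (ht_covBy hr).symm
  obtain ⟨y, rfl⟩ := mergeMk_surjective q
  obtain ⟨z, rfl⟩ := mergeMk_surjective r
  rw [ht_mergeMk, ht_mergeMk] at h
  exact Subtype.ext (Prod.ext (hq.le.1.symm.trans hr.le.1) (ULift.ext _ _ h))

/-- The quotient map onto the merged forest. -/
noncomputable def mergeπ (X : Forest.{w}) : X ⟶ X.merge :=
  homMk mergeMk mergeMk_mono ht_mergeMk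

theorem exists_merge_desc {X Y : Forest.{w}} (hY : isDeterministicForest Y) (f : X ⟶ Y) :
    ∃ g : X.merge ⟶ Y, X.mergeπ ≫ g = f := by
  have key (x y : X.carrier) (h : mergeMk x ≤ mergeMk y) : toFun f x ≤ toFun f y := by
    refine le_of_anc_zero_eq hY ?_ ?_
    · rw [← map_anc f x (Nat.zero_le _), ← map_anc f y (Nat.zero_le _)]
      exact congrArg _ h.1
    · rw [ht_map, ht_map]
      exact h.2
  choose s hs using mergeMk_surjective (X := X)
  refine ⟨homMk (fun p => toFun f (s p)) (fun p q h => key _ _ ?_) fun p => ?_,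
    hom_ext fun x => le_antisymm (key _ _ ?_) (key _ _ ?_)⟩
  · rwa [hs, hs]
  · rw [ht_map, ← ht_mergeMk, hs]
  · exact (hs (mergeMk x)).le
  · exact (hs (mergeMk x)).ge

theorem mergeπ_cancel {X Y : Forest.{w}} {g g' : X.merge ⟶ Y}
    (h : X.mergeπ ≫ g = X.mergeπ ≫ g') : g = g' := hom_ext fun p => by
  obtain ⟨x, rfl⟩ := mergeMk_surjective p
  exact congrArg (fun t => toFun t x) h

/-- Morphisms out of the merged forest. -/
noncomputable def mergeEquiv (X : Forest.{w}) (Y : DetForest.{w}) :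
    ((⟨X.merge, isDeterministicForest_merge X⟩ : DetForest.{w}) ⟶ Y) ≃
      (X ⟶ isDeterministicForest.ι.obj Y) :=
  Equiv.ofBijective (fun g => X.mergeπ ≫ g.hom)
    ⟨fun _ _ h => ObjectProperty.hom_ext _ (mergeπ_cancel h), fun f => by
      obtain ⟨g, hg⟩ := exists_merge_desc Y.property f
      exact ⟨ObjectProperty.homMk g, hg⟩⟩

/-- Deterministic forests are reflective in forests. -/
theorem isRightAdjoint_ι : isDeterministicForest.{w}.ι.IsRightAdjoint :=
  (Adjunction.adjunctionOfEquivLeft mergeEquiv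
    (fun _ _ _ _ _ => rfl)).isRightAdjoint

end Forest

namespace DetForest

attribute [local instance] Cardinal.fact_isRegular_aleph0

theorem preservesFilteredColimits_ι :
    PreservesFilteredColimitsOfSize.{w, w} isDeterministicForest.{w}.ι where
  preserves_filtered_colimits J _ _ := by
    have := Forest.isLocallyFinitelyPresentable.{w}
    infer_instance

theorem isLocallyFinitelyPresentable : IsLocallyFinitelyPresentable.{w} DetForest.{w} := by
  have := Forest.isLocallyFinitelyPresentable.{w}
  have : isDeterministicForest.{w}.ι.IsCardinalAccessible Cardinal.aleph0.{w} :=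
    Functor.IsFinitelyAccessible_iff_preservesFilteredColimitsOfSize.2
      preservesFilteredColimits_ι
  have := Forest.isRightAdjoint_ι.{w}
  exact (Adjunction.ofIsRightAdjoint isDeterministicForest.{w}.ι).isCardinalLocallyPresentable
    Cardinal.aleph0.{w}

end DetForest

/-! ### Colimits of graphs -/

namespace Gph

open Opposite

@[simp] theorem comp_toFun {G H K : Gph.{w}} (f : G ⟶ H) (g : H ⟶ K) (x : G.carrier) :
    Str.toFun (f ≫ g) x = Str.toFun g (Str.toFun f x) := rfl

/-- The vertices of a graph. -/
def vertices : Gph.{w} ⥤ Type w where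
  obj G := G.carrier
  map f := ↾(Str.toFun f)

section Colimits

variable {J : Type w} [SmallCategory J] {D : J ⥤ Gph.{w}}

/-- A cocone of graphs is a colimit if it is one on vertices and every edge of its vertex comes
from the diagram. -/
def isColimitOfVertices (c : Cocone D) (hc : IsColimit (vertices.mapCocone c))
    (he : ∀ a b, c.pt.E a b → ∃ (j : J) (x y : (D.obj j).carrier), (D.obj j).E x y ∧
      Str.toFun (c.ι.app j) x = a ∧ Str.toFun (c.ι.app j) y = b) : IsColimit c :=
  have fac (s : Cocone D) (j : J) (x : (D.obj j).carrier) :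
      hc.desc (vertices.mapCocone s) (Str.toFun (c.ι.app j) x) = Str.toFun (s.ι.app j) x :=
    ConcreteCategory.congr_hom (hc.fac (vertices.mapCocone s) j) x
  { desc s := homMk (fun x : c.pt.carrier => hc.desc (vertices.mapCocone s) x) fun a b h => by
      obtain ⟨j, x, y, hxy, rfl, rfl⟩ := he a b h
      rw [fac, fac]
      exact map_E _ hxy
    fac s j := hom_ext (fac s j)
    uniq s m hm := hom_ext fun x => by
      have := hc.uniq (vertices.mapCocone s) (↾(Str.toFun m)) fun j =>
        ConcreteCategory.hom_ext _ _ fun x => congrArg (fun t => Str.toFun t x) (hm j)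
      exact ConcreteCategory.congr_hom this x }

variable (D) in
/-- The explicit colimit of a diagram of graphs. -/
noncomputable def colimitCocone : Cocone D where
  pt := mk (colimit (D ⋙ vertices)) fun a b => ∃ (j : J) (x y : (D.obj j).carrier),
    (D.obj j).E x y ∧ colimit.ι (D ⋙ vertices) j x = a ∧ colimit.ι (D ⋙ vertices) j y = b
  ι :=
    { app j := homMk (H := mk _ _) (fun x : (D.obj j).carrier => colimit.ι (D ⋙ vertices) j x)
        fun x y h => ⟨j, x, y, h, rfl, rfl⟩
      naturality _ _ f := hom_ext fun x =>
        ConcreteCategory.congr_hom (colimit.w (D ⋙ vertices) f) x }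

variable (D) in
/-- The vertices of `colimitCocone` form a colimit. -/
noncomputable def isColimitMapColimitCocone : IsColimit (vertices.mapCocone (colimitCocone D)) :=
  IsColimit.ofIsoColimit (colimit.isColimit (D ⋙ vertices)) (Cocone.ext (Iso.refl _))

variable (D) in
/-- `colimitCocone` is a colimit. -/
noncomputable def isColimitColimitCocone : IsColimit (colimitCocone D) :=
  isColimitOfVertices _ (isColimitMapColimitCocone D) fun _ _ h => h

instance : HasColimitsOfSize.{w, w} Gph.{w} where
  has_colimits_of_shape _ _ :=
    { has_colimit D := ⟨⟨⟨_, isColimitColimitCocone D⟩⟩⟩ }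

instance : PreservesColimitsOfSize.{w, w} vertices.{w} where
  preservesColimitsOfShape :=
    { preservesColimit {D} := preservesColimit_of_preserves_colimit_cocone
        (isColimitColimitCocone D) (isColimitMapColimitCocone D) }

variable {c : Cocone D}

theorem exists_vertex_of_isColimit (hc : IsColimit c) (a : c.pt.carrier) :
    ∃ (j : J) (x : (D.obj j).carrier), Str.toFun (c.ι.app j) x = a :=
  Types.jointly_surjective_of_isColimit (isColimitOfPreserves vertices hc) a

theorem exists_edge_of_isColimit (hc : IsColimit c) {a b : c.pt.carrier} (h : c.pt.E a b) :
    ∃ (j : J) (x y : (D.obj j).carrier), (D.obj j).E x y ∧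
      Str.toFun (c.ι.app j) x = a ∧ Str.toFun (c.ι.app j) y = b := by
  -- The graph of the edges which come from the diagram is the vertex of a cocone, so that the
  -- identity map on vertices is a morphism to it.
  let K : Gph.{w} := mk c.pt.carrier fun a b => ∃ (j : J) (x y : (D.obj j).carrier),
    (D.obj j).E x y ∧ Str.toFun (c.ι.app j) x = a ∧ Str.toFun (c.ι.app j) y = b
  let s : Cocone D :=
    { pt := K
      ι :=
        { app j := homMk (G := D.obj j) (H := K)
            (fun x => (Str.toFun (c.ι.app j) x : c.pt.carrier))
            fun x y h => ⟨j, x, y, h, rfl, rfl⟩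
          naturality _ _ f := hom_ext fun x =>
            congrArg (fun t : _ ⟶ c.pt => Str.toFun t x) (c.w f) } }
  let i : K ⟶ c.pt := homMk id (by
    rintro _ _ ⟨j, x, y, h, rfl, rfl⟩
    exact map_E _ h)
  have e : hc.desc s ≫ i = 𝟙 _ := hc.hom_ext fun j => by
    rw [hc.fac_assoc, Category.comp_id]
    rfl
  have e' (x) : Str.toFun (hc.desc s) x = x := congrArg (fun t => Str.toFun t x) e
  have := map_E (hc.desc s) h
  rwa [e', e'] at this

variable [IsFiltered J]

theorem exists_eq_of_isColimit (hc : IsColimit c) {i j : J} (x : (D.obj i).carrier)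
    (y : (D.obj j).carrier) (h : Str.toFun (c.ι.app i) x = Str.toFun (c.ι.app j) y) :
    ∃ (k : J) (f : i ⟶ k) (g : j ⟶ k), Str.toFun (D.map f) x = Str.toFun (D.map g) y :=
  (Types.FilteredColimit.isColimit_eq_iff _ (isColimitOfPreserves vertices hc)).1 h

theorem exists_list_map_eq_of_isColimit (hc : IsColimit c) {i j : J} (p : List (D.obj i).carrier)
    (q : List (D.obj j).carrier)
    (h : p.map (Str.toFun (c.ι.app i)) = q.map (Str.toFun (c.ι.app j))) :
    ∃ (k : J) (f : i ⟶ k) (g : j ⟶ k),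
      p.map (Str.toFun (D.map f)) = q.map (Str.toFun (D.map g)) := by
  induction p generalizing q with
  | nil =>
    obtain rfl : q = [] := by simpa using h.symm
    exact ⟨_, IsFiltered.leftToMax i j, IsFiltered.rightToMax i j, rfl⟩
  | cons x p ih =>
    cases q with
    | nil => simp at h
    | cons y q =>
      rw [List.map_cons, List.map_cons, List.cons.injEq] at h
      obtain ⟨k, f, g, hk⟩ := ih q h.2
      obtain ⟨k', f', g', hk'⟩ := exists_eq_of_isColimit hc x y h.1
      obtain ⟨l, α, β, h₁, h₂⟩ := IsFiltered.bowtie f f' g g'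
      refine ⟨l, f ≫ α, g ≫ α, ?_⟩
      have e := congrArg (List.map (Str.toFun (D.map α))) hk
      have e' := congrArg (Str.toFun (D.map β)) hk'
      rw [List.map_map, List.map_map] at e
      rw [← comp_toFun, ← comp_toFun, ← D.map_comp, ← D.map_comp, ← h₁, ← h₂] at e'
      rw [List.map_cons, List.map_cons, e']
      simp only [D.map_comp]
      exact congrArg _ e

theorem exists_walk_of_isColimit (hc : IsColimit c) (l : List c.pt.carrier) (hl : l ≠ [])
    (h : l.IsChain c.pt.E) : ∃ (j : J) (p : List (D.obj j).carrier), p.IsChain (D.obj j).E ∧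
      p.map (Str.toFun (c.ι.app j)) = l := by
  induction l with
  | nil => exact absurd rfl hl
  | cons a l ih =>
    cases l with
    | nil =>
      obtain ⟨j, x, rfl⟩ := exists_vertex_of_isColimit hc a
      exact ⟨j, [x], by simp, rfl⟩
    | cons b l =>
      rw [List.isChain_cons_cons] at h
      obtain ⟨j, p, hp, hp'⟩ := ih (by simp) h.2
      obtain ⟨i, x, z, hxz, rfl, hz⟩ := exists_edge_of_isColimit hc h.1
      cases p with
      | nil => simp at hp'
      | cons y p =>
        rw [List.map_cons, List.cons.injEq] at hp'
        obtain ⟨k, f, g, hk⟩ := exists_eq_of_isColimit hc z y (hz.trans hp'.1.symm)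
        refine ⟨k, Str.toFun (D.map f) x :: (y :: p).map (Str.toFun (D.map g)), ?_, ?_⟩
        · have h₁ := List.isChain_map_of_isChain (Str.toFun (D.map g))
            (fun _ _ h => map_E (D.map g) h) hp
          rw [List.map_cons] at h₁ ⊢
          refine List.isChain_cons_cons.2 ⟨?_, h₁⟩
          rw [← hk]
          exact map_E _ hxz
        · have e (t) : Str.toFun (c.ι.app k) (Str.toFun (D.map g) t) =
              Str.toFun (c.ι.app j) t := congrArg (fun m => Str.toFun m t) (c.w g)
          have e' : Str.toFun (c.ι.app k) (Str.toFun (D.map f) x) =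
              Str.toFun (c.ι.app i) x := congrArg (fun m => Str.toFun m x) (c.w f)
          simp [e, e', hp'.1, ← hp'.2]

theorem isDeterministicGraph_of_isColimit (hc : IsColimit c)
    (hD : ∀ j, isDeterministicGraph (D.obj j)) : isDeterministicGraph c.pt := by
  intro a b b' h h'
  obtain ⟨i, x, y, hxy, rfl, rfl⟩ := exists_edge_of_isColimit hc h
  obtain ⟨j, x', y', hxy', hx', rfl⟩ := exists_edge_of_isColimit hc h'
  obtain ⟨k, f, g, hk⟩ := exists_eq_of_isColimit hc x x' hx'.symm
  have e := hD k _ _ _ (map_E (D.map f) hxy) (hk ▸ map_E (D.map g) hxy')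
  rw [← c.w f, ← c.w g, comp_toFun, comp_toFun, e]

end Colimits

instance (J : Type w) [SmallCategory J] [IsFiltered J] :
    isDeterministicGraph.{w}.IsClosedUnderColimitsOfShape J where
  colimitsOfShape_le _ := fun ⟨p⟩ =>
    isDeterministicGraph_of_isColimit p.isColimit p.prop_diag_obj

/-! ### Graphs form a locally finitely presentable category -/

attribute [local instance] Cardinal.fact_isRegular_aleph0

/-- The graph with one vertex and no edge. -/
def point : Gph.{w} := mk PUnit fun _ _ => False

/-- The graph with two vertices and one edge between them. -/
def edge : Gph.{w} := mk (ULift.{w} Bool) fun a b => a.down = false ∧ b.down = true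

/-- The morphism from `point` picking a vertex. -/
def pointHom {G : Gph.{w}} (x : G.carrier) : point.{w} ⟶ G :=
  homMk (G := mk _ _) (fun _ => x) fun _ _ h => h.elim

/-- The morphism from `edge` picking an edge. -/
def edgeHom {G : Gph.{w}} {x y : G.carrier} (h : G.E x y) : edge.{w} ⟶ G :=
  homMk (G := mk _ _) (fun b => bif b.down then y else x) (by
    rintro ⟨_⟩ ⟨_⟩ ⟨rfl, rfl⟩
    exact h)

theorem edge_hom_ext {G : Gph.{w}} {f g : edge.{w} ⟶ G}
    (h₀ : Str.toFun f ⟨false⟩ = Str.toFun g ⟨false⟩)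
    (h₁ : Str.toFun f ⟨true⟩ = Str.toFun g ⟨true⟩) : f = g := hom_ext (by
  rintro ⟨_ | _⟩
  exacts [h₀, h₁])

theorem edge_E : edge.{w}.E ⟨false⟩ ⟨true⟩ := ⟨rfl, rfl⟩

theorem isFinitelyPresentable_point : IsFinitelyPresentable.{w} point.{w} := by
  rw [isFinitelyPresentable_iff_preservesFilteredColimitsOfSize]
  refine ⟨fun J _ _ => ⟨fun {D} => ⟨fun {c} hc => ⟨?_⟩⟩⟩⟩
  refine Types.FilteredColimit.isColimitOf _ _ (fun f => ?_) (fun i j f g h => ?_)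
  · obtain ⟨j, x, hx⟩ := exists_vertex_of_isColimit hc (Str.toFun (f : point ⟶ c.pt) ⟨⟩)
    exact ⟨j, pointHom x, hom_ext fun _ => hx.symm⟩
  · obtain ⟨k, u, v, hk⟩ := exists_eq_of_isColimit hc
      (Str.toFun (f : point ⟶ D.obj i) ⟨⟩) (Str.toFun (g : point ⟶ D.obj j) ⟨⟩)
      (congrArg (fun t : point ⟶ c.pt => Str.toFun t ⟨⟩) h)
    exact ⟨k, u, v, hom_ext fun _ => hk⟩

theorem isFinitelyPresentable_edge : IsFinitelyPresentable.{w} edge.{w} := by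
  rw [isFinitelyPresentable_iff_preservesFilteredColimitsOfSize]
  refine ⟨fun J _ _ => ⟨fun {D} => ⟨fun {c} hc => ⟨?_⟩⟩⟩⟩
  refine Types.FilteredColimit.isColimitOf _ _ (fun f => ?_) (fun i j f g h => ?_)
  · obtain ⟨j, x, y, hxy, hx, hy⟩ := exists_edge_of_isColimit hc
      (map_E (f : edge ⟶ c.pt) edge_E)
    exact ⟨j, edgeHom hxy, edge_hom_ext hx.symm hy.symm⟩
  · let p {G : Gph.{w}} (t : edge.{w} ⟶ G) : List G.carrier :=
      [Str.toFun t ⟨false⟩, Str.toFun t ⟨true⟩]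
    obtain ⟨k, u, v, hk⟩ := exists_list_map_eq_of_isColimit hc (p (f : edge ⟶ D.obj i))
      (p (g : edge ⟶ D.obj j)) (congrArg (fun t : edge ⟶ c.pt => p t) h)
    simp only [p, List.map_cons, List.map_nil, List.cons.injEq, and_true] at hk
    exact ⟨k, u, v, edge_hom_ext hk.1 hk.2⟩

theorem isStrongGenerator_point_edge :
    (ObjectProperty.ofObj fun b : Bool => bif b then edge.{w} else point.{w}).IsStrongGenerator
    := by
  rw [ObjectProperty.isStrongGenerator_iff]
  have hp := ObjectProperty.ofObj_apply (fun b : Bool => bif b then edge.{w} else point.{w}) false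
  have he := ObjectProperty.ofObj_apply (fun b : Bool => bif b then edge.{w} else point.{w}) true
  refine ⟨fun G H f g h => hom_ext fun x => ?_, fun G H i _ h => ?_⟩
  · exact congrArg (fun t : point ⟶ H => Str.toFun t ⟨⟩) (h _ hp (pointHom x))
  · have hinj : Function.Injective (Str.toFun i) := fun x y hxy => by
      have := (cancel_mono i).1 (show pointHom x ≫ i = pointHom y ≫ i from hom_ext fun _ => hxy)
      exact congrArg (fun t : point ⟶ G => Str.toFun t ⟨⟩) this
    have hsurj : Function.Surjective (Str.toFun i) := fun y => by
      obtain ⟨f, hf⟩ := h _ hp (pointHom y)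
      exact ⟨Str.toFun (f : point ⟶ G) ⟨⟩, congrArg (fun t : point ⟶ H => Str.toFun t ⟨⟩) hf⟩
    have hE (x y) (hxy : H.E (Str.toFun i x) (Str.toFun i y)) : G.E x y := by
      obtain ⟨f, hf⟩ := h _ he (edgeHom hxy)
      have h₀ : Str.toFun (f : edge ⟶ G) ⟨false⟩ = x :=
        hinj (congrArg (fun t : edge ⟶ H => Str.toFun t ⟨false⟩) hf)
      have h₁ : Str.toFun (f : edge ⟶ G) ⟨true⟩ = y :=
        hinj (congrArg (fun t : edge ⟶ H => Str.toFun t ⟨true⟩) hf)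
      exact h₀ ▸ h₁ ▸ map_E (f : edge ⟶ G) edge_E
    choose s hs using hsurj
    exact ⟨homMk s fun a b hab => hE _ _ (by rwa [hs, hs]),
      hom_ext fun x => hinj (hs _), hom_ext hs⟩

theorem isLocallyFinitelyPresentable : IsLocallyFinitelyPresentable.{w} Gph.{w} := by
  refine (IsCardinalLocallyPresentable.iff_exists_isStrongGenerator _ _).2
    ⟨_, inferInstance, isStrongGenerator_point_edge, ?_⟩
  rintro _ ⟨_ | _⟩
  exacts [isFinitelyPresentable_point, isFinitelyPresentable_edge]

end Gph

/-! ### The reflection of graphs into deterministic graphs -/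

namespace DetGph

attribute [local instance] Cardinal.fact_isRegular_aleph0

theorem eq_of_detRel {G H : Gph.{w}} (hH : isDeterministicGraph H) (f : G ⟶ H)
    {x y : G.carrier} (h : DetRel G x y) : Str.toFun f x = Str.toFun f y := by
  induction h with
  | refl _ => rfl
  | symm _ ih => exact ih.symm
  | trans _ _ ih₁ ih₂ => exact ih₁.trans ih₂
  | step _ h₁ h₂ ih => exact hH _ _ _ (Gph.map_E f h₁) (ih ▸ Gph.map_E f h₂)

/-- Morphisms out of the deterministic quotient of a graph. -/
def detQuotientEquiv (G : Gph.{w}) (H : DetGph.{w}) :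
    (detReflection.obj G ⟶ H) ≃ (G ⟶ detInclusion.obj H) where
  toFun f := Gph.homMk (fun x => Str.toFun f.hom (Quotient.mk (detSetoid G) x))
    fun x y h => Gph.map_E f.hom ⟨x, y, rfl, rfl, h⟩
  invFun g := ObjectProperty.homMk (Gph.homMk (G := detQuotient G)
    (Quotient.lift (s := detSetoid G) (Str.toFun g) fun _ _ h => eq_of_detRel H.property g h) (by
      rintro _ _ ⟨x, y, rfl, rfl, h⟩
      exact Gph.map_E g h))
  left_inv f := ObjectProperty.hom_ext _ (Gph.hom_ext (by rintro ⟨x⟩; rfl))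
  right_inv g := rfl

/-- The reflection of graphs into deterministic graphs. -/
def detAdjunction : detReflection.{w} ⊣ detInclusion.{w} :=
  Adjunction.mkOfHomEquiv
    { homEquiv := detQuotientEquiv
      homEquiv_naturality_left_symm := fun f g =>
        ObjectProperty.hom_ext _ (Gph.hom_ext (by rintro ⟨x⟩; rfl))
      homEquiv_naturality_right := fun f g => rfl }

theorem preservesFilteredColimits_detInclusion :
    PreservesFilteredColimitsOfSize.{w, w} detInclusion.{w} where
  preserves_filtered_colimits _ _ _ := inferInstance

theorem isLocallyFinitelyPresentable : IsLocallyFinitelyPresentable.{w} DetGph.{w} := by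
  have := Gph.isLocallyFinitelyPresentable.{w}
  have : detInclusion.{w}.IsCardinalAccessible Cardinal.aleph0.{w} :=
    Functor.IsFinitelyAccessible_iff_preservesFilteredColimitsOfSize.2
      preservesFilteredColimits_detInclusion
  exact detAdjunction.isCardinalLocallyPresentable Cardinal.aleph0.{w}

theorem isFinitelyAccessibleAdjunction_detAdjunction :
    IsFinitelyAccessibleAdjunction.{w} detAdjunction.{w} :=
  ⟨Gph.isLocallyFinitelyPresentable, isLocallyFinitelyPresentable,
    preservesFilteredColimits_detInclusion⟩

end DetGph

/-! ### The adjunction between forests and graphs -/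

namespace Walk

variable {G H : Gph.{w}}

/-- The last vertex of a walk. -/
def last (p : Walk G) : G.carrier := p.1.getLast p.2.1

theorem E_last_of_append {p q : Walk G} {a : G.carrier} (h : q.1 = p.1 ++ [a]) :
    G.E p.last a := by
  have := q.2.2
  rw [h, List.isChain_append] at this
  exact this.2.2 _ (List.getLast?_eq_some_getLast p.2.1) a rfl

theorem last_of_append {p q : Walk G} {a : G.carrier} (h : q.1 = p.1 ++ [a]) : q.last = a := by
  simp [last, h]

@[simp] theorem last_map (f : G ⟶ H) (p : Walk G) : (map f p).last = Str.toFun f p.last :=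
  List.getLast_map _

theorem E_last_of_covBy {p q : Walk G} (h : p ⋖ q) : G.E p.last q.last := by
  obtain ⟨a, ha⟩ := (covBy_iff p q).1 h
  rw [last_of_append ha]
  exact E_last_of_append ha

/-- A family of walks indexed by a forest, i.e. a morphism to the forest of walks, is determined
by the last vertices of the walks. -/
theorem eq_of_last_eq {X : Forest.{w}} {f g : X ⟶ walkForest.obj G}
    (h : ∀ x, last (G := G) (Forest.toFun f x) = last (G := G) (Forest.toFun g x)) : f = g :=
  Forest.hom_ext fun x => by
    induction x using Forest.induction with
    | root x hx =>
      obtain ⟨a, ha⟩ := (isMin_iff (G := G) _).1 (Forest.isMin_map f hx)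
      obtain ⟨b, hb⟩ := (isMin_iff (G := G) _).1 (Forest.isMin_map g hx)
      have := h x
      simp only [last, ha, hb, List.getLast_singleton] at this
      exact Subtype.ext (by rw [ha, hb, this])
    | covBy x y hxy ih =>
      obtain ⟨a, ha⟩ := (covBy_iff (G := G) _ _).1 (Forest.covBy_map f hxy)
      obtain ⟨b, hb⟩ := (covBy_iff (G := G) _ _).1 (Forest.covBy_map g hxy)
      have := h y
      rw [last_of_append ha, last_of_append hb] at this
      exact Subtype.ext (by rw [ha, hb, this, ih])

end Walk

namespace Forest

variable {X : Forest.{w}}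

/-- The nodes below `x`, listed from the root up to `x`. -/
noncomputable def branch (x : X.carrier) : List X.carrier :=
  List.ofFn fun i : Fin (ht x + 1) => anc x i

theorem branch_of_isMin {x : X.carrier} (hx : IsMin x) : branch x = [x] := by
  have h := ht_eq_zero_iff.2 hx
  refine List.ext_getElem (by simp [branch, h]) fun i h₁ h₂ => ?_
  obtain rfl : i = 0 := by simpa using h₂
  simpa [branch] using anc_eq le_rfl h

theorem branch_of_covBy {x y : X.carrier} (h : x ⋖ y) : branch y = branch x ++ [y] := by
  have hh := ht_covBy h
  refine List.ext_getElem (by simp [branch, hh]) fun i h₁ h₂ => ?_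
  rcases Nat.lt_or_ge i (ht x + 1) with hi | hi
  · rw [List.getElem_append_left (by simpa [branch] using hi)]
    simp only [branch, List.getElem_ofFn]
    exact anc_eq_of_le h.le (by omega)
  · obtain rfl : i = ht x + 1 := by simp [branch] at h₂; omega
    rw [List.getElem_append_right (by simp [branch])]
    simpa [branch] using anc_eq le_rfl hh

theorem branch_ne_nil (x : X.carrier) : branch x ≠ [] := fun h => by
  have := congrArg List.length h
  simp [branch] at this

theorem getLast_branch (x : X.carrier) : (branch x).getLast (branch_ne_nil x) = x := by
  by_cases hx : IsMin x
  · simp [branch_of_isMin hx]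
  · obtain ⟨y, hy⟩ := exists_covBy_of_not_isMin hx
    simp [branch_of_covBy hy]

/-- The walk in the covering graph from the root to `x`. -/
noncomputable def branchWalk (x : X.carrier) : Walk (coverGraph.obj X) :=
  ⟨branch x, branch_ne_nil x, by
    have h : (branch x).getLast? = some x ∧
        (branch x).IsChain (fun a b : X.carrier => a ⋖ b) := by
      induction x using induction with
      | root x hx => simp [branch_of_isMin hx]
      | covBy x y hxy ih => simp [branch_of_covBy hxy, List.isChain_append, ih.1, ih.2, hxy]
    exact h.2⟩

theorem last_branchWalk (x : X.carrier) : (branchWalk x).last = x := getLast_branch x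

/-- The correspondence between morphisms out of the covering graph of a forest and morphisms into
the forest of walks: a walk is assigned to a node by applying the graph morphism to its branch,
and conversely a walk is sent to its last vertex. -/
noncomputable def walkEquiv (X : Forest.{w}) (G : Gph.{w}) :
    (coverGraph.obj X ⟶ G) ≃ (X ⟶ walkForest.obj G) where
  toFun f :=
    { toFun x := Walk.map f (branchWalk x)
      map_isMin _ hx := (Walk.isMin_iff _).2
        ⟨_, congrArg (List.map (Str.toFun f)) (branch_of_isMin hx)⟩
      map_covBy _ _ h := (Walk.covBy_iff _ _).2
        ⟨_, (congrArg (List.map (Str.toFun f)) (branch_of_covBy h)).trans List.map_append⟩ }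
  invFun g := Gph.homMk (G := coverGraph.obj X) (fun x => Walk.last (G := G) (toFun g x))
    fun _ _ h => Walk.E_last_of_covBy (covBy_map g h)
  left_inv f := Gph.hom_ext fun x =>
    (Walk.last_map f (branchWalk (X := X) x)).trans
      (congrArg (Str.toFun f) (last_branchWalk (X := X) x))
  right_inv _ := Walk.eq_of_last_eq fun x =>
    (Walk.last_map _ (branchWalk x)).trans (congrArg (Str.toFun _) (last_branchWalk x))

/-- The adjunction between covering graphs and forests of walks. -/
noncomputable def walkAdjunction : coverGraph.{w} ⊣ walkForest.{w} :=
  Adjunction.mkOfHomEquiv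
    { homEquiv := walkEquiv
      homEquiv_naturality_left_symm := fun _ _ => rfl
      homEquiv_naturality_right := fun f g => Walk.eq_of_last_eq fun x => by
        change Walk.last (Walk.map (f ≫ g) (branchWalk x)) =
          Walk.last (Walk.map g (Walk.map f (branchWalk x)))
        simp only [Walk.last_map, Gph.comp_toFun] }

theorem preservesFilteredColimits_walkForest :
    PreservesFilteredColimitsOfSize.{w, w} walkForest.{w} := by
  refine ⟨fun J _ _ => ⟨fun {D} => ⟨fun {c} hc => nonempty_isColimit _ (fun p => ?_)
    fun i j p q h => ?_⟩⟩⟩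
  · obtain ⟨j, l, hl, hp⟩ := Gph.exists_walk_of_isColimit hc (p : Walk c.pt).1
      (p : Walk c.pt).2.1 (p : Walk c.pt).2.2
    refine ⟨j, (⟨l, ?_, hl⟩ : Walk (D.obj j)), Subtype.ext hp⟩
    rintro rfl
    exact (p : Walk c.pt).2.1 hp.symm
  · obtain ⟨k, f, g, hk⟩ := Gph.exists_list_map_eq_of_isColimit hc (p : Walk (D.obj i)).1
      (q : Walk (D.obj j)).1 (congrArg (fun r : Walk c.pt => r.1) h)
    exact ⟨k, f, g, Subtype.ext hk⟩

theorem isFinitelyAccessibleAdjunction_walkAdjunction :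
    IsFinitelyAccessibleAdjunction.{w} walkAdjunction.{w} :=
  ⟨isLocallyFinitelyPresentable, Gph.isLocallyFinitelyPresentable,
    preservesFilteredColimits_walkForest⟩

end Forest

namespace DetForest

/-- The restriction of the adjunction between covering graphs and forests of walks to the
deterministic objects. -/
noncomputable def detWalkAdjunction : detCoverGraph.{w} ⊣ detWalkForest.{w} :=
  Forest.walkAdjunction.restrictFullyFaithful isDeterministicForest.fullyFaithfulι
    isDeterministicGraph.fullyFaithfulι (Iso.refl _) (Iso.refl _)

theorem preservesFilteredColimits_detWalkForest :
    PreservesFilteredColimitsOfSize.{w, w} detWalkForest.{w} where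
  preserves_filtered_colimits J _ _ := by
    have := DetGph.preservesFilteredColimits_detInclusion.{w}
    have := Forest.preservesFilteredColimits_walkForest.{w}
    have : PreservesColimitsOfShape J (detWalkForest.{w} ⋙ isDeterministicForest.ι) :=
      inferInstanceAs (PreservesColimitsOfShape J (detInclusion.{w} ⋙ walkForest.{w}))
    exact preservesColimitsOfShape_of_reflects_of_preserves _ isDeterministicForest.ι

theorem isFinitelyAccessibleAdjunction_detWalkAdjunction :
    IsFinitelyAccessibleAdjunction.{w} detWalkAdjunction.{w} :=
  ⟨isLocallyFinitelyPresentable, DetGph.isLocallyFinitelyPresentable,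
    preservesFilteredColimits_detWalkForest⟩

end DetForest

/-! ### The factorisation system on deterministic forests -/

namespace DetForest

open Forest

variable {X Y Z : DetForest.{w}}

/-- A morphism whose values are values of an embedding `m` factors through `m`. -/
theorem exists_lift (f : Z ⟶ X) (m : Y ⟶ X) (hm : injectiveMorphisms m)
    (h : ∀ z, ∃ y, toFun m.hom y = toFun f.hom z) : ∃ l : Z ⟶ Y, l ≫ m = f := by
  obtain ⟨l, hl⟩ := Forest.exists_lift f.hom m.hom hm h
  exact ⟨ObjectProperty.homMk l, ObjectProperty.hom_ext _ hl⟩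

theorem hom_ext {f g : X ⟶ Y} (h : ∀ x, toFun f.hom x = toFun g.hom x) : f = g :=
  ObjectProperty.hom_ext _ (Forest.hom_ext h)

theorem congr_toFun {f g : X ⟶ Y} (h : f = g) (x : X.obj.carrier) :
    toFun f.hom x = toFun g.hom x := by rw [h]

theorem mono_of_injective (m : X ⟶ Y) (hm : injectiveMorphisms m) : Mono m where
  right_cancellation _ _ h := hom_ext fun x => hm (congr_toFun h x)

theorem epi_of_surjective (e : X ⟶ Y) (he : surjectiveMorphisms e) : Epi e where
  left_cancellation _ _ h := hom_ext fun y => by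
    obtain ⟨x, rfl⟩ := he y
    exact congr_toFun h x

/-- The restriction of a deterministic forest to a lower set. -/
def sub (X : DetForest.{w}) (S : Set X.obj.carrier) (hS : IsLowerSet S) : DetForest.{w} :=
  ⟨X.obj.sub S hS, isDeterministicForest_of_injective _ (subι_injective S hS) X.property⟩

/-- The inclusion of a lower set. -/
def subι (X : DetForest.{w}) (S : Set X.obj.carrier) (hS : IsLowerSet S) : X.sub S hS ⟶ X :=
  ObjectProperty.homMk (X.obj.subι S hS)

theorem injective_subι (S : Set X.obj.carrier) (hS : IsLowerSet S) :
    injectiveMorphisms (X.subι S hS) := subι_injective S hS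

theorem isLowerSet_range (f : X ⟶ Y) : IsLowerSet (Set.range (toFun f.hom)) := by
  rintro _ y hy ⟨x, rfl⟩
  obtain ⟨z, -, hz⟩ := exists_le_map_eq f.hom hy
  exact ⟨z, hz⟩

/-- Morphisms preserve heights, and the nodes of a chain have different heights. -/
theorem injective_of_total (hX : ∀ x y : X.obj.carrier, x ≤ y ∨ y ≤ x) (f : X ⟶ Y) :
    injectiveMorphisms f := fun x y h => by
  have hh : ht x = ht y := by rw [← ht_map f.hom, h, ht_map]
  rcases hX x y with h' | h'
  · exact eq_of_le_of_ht_le h' hh.ge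
  · exact (eq_of_le_of_ht_le h' hh.le).symm

/-- The path of the nodes below `x`. -/
def below (x : X.obj.carrier) : DetForest.{w} := X.sub (Set.Iic x) (isLowerSet_Iic x)

/-- The inclusion of the path of the nodes below `x`. -/
def belowι (x : X.obj.carrier) : below x ⟶ X := X.subι (Set.Iic x) (isLowerSet_Iic x)

theorem injective_belowι (x : X.obj.carrier) : injectiveMorphisms (belowι x) :=
  injective_subι _ _

theorem below_total (x : X.obj.carrier) (y z : (below x).obj.carrier) : y ≤ z ∨ z ≤ y :=
  le_total_of_le (X := X.obj) y.2 z.2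

/-- The largest element of `below x`. -/
def belowTop (x : X.obj.carrier) : (below x).obj.carrier := ⟨x, le_rfl⟩

/-- If a monomorphism identified two nodes, it would identify the branches below them. -/
theorem injective_of_mono (m : X ⟶ Y) [Mono m] : injectiveMorphisms m := fun x y h => by
  obtain ⟨l, hl⟩ := exists_lift (belowι x ≫ m) (belowι y ≫ m)
    (injective_of_total (below_total y) _) fun z => by
      obtain ⟨u, hu, hu'⟩ := exists_le_map_eq m.hom (h ▸ map_le m.hom z.2)
      exact ⟨⟨u, hu⟩, hu'⟩
  rw [← Category.assoc, cancel_mono] at hl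
  have hxy : x ≤ y := by
    have e : (toFun l.hom (belowTop x)).1 = x := congr_toFun hl (belowTop x)
    rw [← e]
    exact (toFun l.hom (belowTop x)).2
  refine eq_of_le_of_ht_le hxy ?_
  rw [← ht_map m.hom, ← ht_map m.hom, h]

theorem hasLiftingProperty {A B : DetForest.{w}} (e : A ⟶ B) (m : X ⟶ Y)
    (he : surjectiveMorphisms e) (hm : injectiveMorphisms m) : HasLiftingProperty e m where
  sq_hasLift {f g} sq := by
    obtain ⟨l, hl⟩ := exists_lift g m hm fun b => by
      obtain ⟨a, rfl⟩ := he b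
      exact ⟨_, congr_toFun sq.w a⟩
    have := mono_of_injective m hm
    exact ⟨⟨⟨l, by rw [← cancel_mono m, Category.assoc, hl, sq.w], hl⟩⟩⟩

instance : surjectiveMorphisms.{w}.IsStableUnderRetracts where
  of_retract {X Y Z W f g} h hg y := by
    obtain ⟨x, hx⟩ := hg (toFun h.right.i.hom y)
    refine ⟨toFun h.left.r.hom x, ?_⟩
    exact (congr_toFun h.r_w x).trans
      ((congrArg (toFun h.r.right.hom) hx).trans (congr_toFun h.right.retract y))

instance : injectiveMorphisms.{w}.IsStableUnderRetracts where
  of_retract {X Y Z W f g} h hg x y hxy := by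
    have e : toFun h.i.left.hom x = toFun h.i.left.hom y :=
      hg ((congr_toFun h.i_w x).trans
        ((congrArg (toFun h.i.right.hom) hxy).trans (congr_toFun h.i_w y).symm))
    exact (congr_toFun h.left.retract x).symm.trans
      ((congrArg (toFun h.r.left.hom) e).trans (congr_toFun h.left.retract y))

theorem exists_factorisation (f : X ⟶ Y) : ∃ (I : DetForest.{w}) (e : X ⟶ I) (m : I ⟶ Y),
    e ≫ m = f ∧ surjectiveMorphisms e ∧ injectiveMorphisms m := by
  obtain ⟨e, he⟩ := exists_lift f (Y.subι _ (isLowerSet_range f)) (injective_subι _ _)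
    fun x => ⟨⟨_, x, rfl⟩, rfl⟩
  refine ⟨_, e, _, he, ?_, injective_subι _ _⟩
  rintro ⟨_, x, rfl⟩
  exact ⟨x, Subtype.ext (congr_toFun he x)⟩

instance : MorphismProperty.HasFactorization surjectiveMorphisms.{w} injectiveMorphisms.{w} where
  nonempty_mapFactorizationData f := by
    obtain ⟨I, e, m, h, he, hm⟩ := exists_factorisation f
    exact ⟨⟨I, e, m, h, he, hm⟩⟩

theorem isStableFactorisationSystem :
    IsStableFactorisationSystem surjectiveMorphisms.{w} injectiveMorphisms.{w} where
  isWeakFactorisationSystem := .mk' _ _ hasLiftingProperty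
  epi_of_quotient := epi_of_surjective
  mono_of_embedding := mono_of_injective
  stable {X Y Z} e m he hm := by
    let S : Set X.obj.carrier := {x | toFun e.hom x ∈ Set.range (toFun m.hom)}
    have hS : IsLowerSet S := fun _ _ h => isLowerSet_range m (map_le e.hom h)
    obtain ⟨q, hq⟩ := exists_lift (X.subι S hS ≫ e) m hm fun x => x.2
    have := mono_of_injective m hm
    have := mono_of_injective _ (injective_subι S hS)
    have hl (s : PullbackCone e m) : ∃ l, l ≫ X.subι S hS = s.fst :=
      exists_lift s.fst (X.subι S hS) (injective_subι _ _)
        fun z => ⟨⟨_, toFun s.snd.hom z, (congr_toFun s.condition z).symm⟩, rfl⟩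
    choose l hl using hl
    refine ⟨X.sub S hS, X.subι S hS, q, ⟨⟨hq.symm⟩, ⟨PullbackCone.IsLimit.mk hq.symm l hl
      (fun s => ?_) (fun s l' h _ => ?_)⟩⟩, fun y => ?_⟩
    · rw [← cancel_mono m, Category.assoc, hq, ← s.condition, ← Category.assoc, hl]
    · rw [← cancel_mono (X.subι S hS), h, hl]
    · obtain ⟨x, hx⟩ := he (toFun m.hom y)
      exact ⟨⟨x, y, hx.symm⟩, hm ((congr_toFun hq _).trans hx)⟩

/-! ### Paths of deterministic forests -/

theorem subobject_le_iff (S T : Subobject X) :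
    S ≤ T ↔ Set.range (toFun S.arrow.hom) ⊆ Set.range (toFun T.arrow.hom) := by
  constructor
  · rintro h _ ⟨x, rfl⟩
    exact ⟨_, congr_toFun (Subobject.ofLE_arrow h) x⟩
  · intro h
    obtain ⟨l, hl⟩ := exists_lift S.arrow T.arrow (injective_of_mono _) fun z => h ⟨z, rfl⟩
    exact Subobject.le_of_comm l hl

theorem range_arrow_injective :
    Function.Injective fun S : Subobject X => Set.range (toFun S.arrow.hom) := fun S T h =>
  le_antisymm ((subobject_le_iff S T).2 h.subset) ((subobject_le_iff T S).2 h.symm.subset)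

/-- A lower set as an embedding. -/
noncomputable def subEmb (S : Set X.obj.carrier) (hS : IsLowerSet S) :
    Emb injectiveMorphisms X :=
  have := mono_of_injective _ (injective_subι S hS)
  ⟨Subobject.mk (X.subι S hS), injective_of_mono _⟩

theorem range_subEmb (S : Set X.obj.carrier) (hS : IsLowerSet S) :
    Set.range (toFun (subEmb S hS).1.arrow.hom) = S := by
  have := mono_of_injective _ (injective_subι S hS)
  apply Set.Subset.antisymm
  · rintro _ ⟨x, rfl⟩
    have e := congr_toFun (Subobject.underlyingIso_hom_comp_eq_mk (X.subι S hS)) x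
    exact e ▸ (toFun (Subobject.underlyingIso (X.subι S hS)).hom.hom x).2
  · intro x hx
    exact ⟨_, congr_toFun (Subobject.underlyingIso_arrow (X.subι S hS)) ⟨x, hx⟩⟩

theorem emb_le_iff (S T : Emb injectiveMorphisms X) :
    S ≤ T ↔ Set.range (toFun S.1.arrow.hom) ⊆ Set.range (toFun T.1.arrow.hom) :=
  subobject_le_iff S.1 T.1

/-- The paths of deterministic forests are the finite chains. -/
theorem isPath_iff : isPath injectiveMorphisms X ↔
    Finite X.obj.carrier ∧ ∀ x y : X.obj.carrier, x ≤ y ∨ y ≤ x := by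
  constructor
  · rintro ⟨h₁, h₂⟩
    have key (x y : X.obj.carrier)
        (h : subEmb _ (isLowerSet_Iic x) ≤ subEmb _ (isLowerSet_Iic y)) : x ≤ y := by
      rw [emb_le_iff, range_subEmb, range_subEmb] at h
      exact h le_rfl
    refine ⟨Finite.of_injective (fun x : X.obj.carrier => subEmb _ (isLowerSet_Iic x))
      fun x y h => le_antisymm (key x y h.le) (key y x h.ge), fun x y => ?_⟩
    exact (h₂ (subEmb _ (isLowerSet_Iic x)) (subEmb _ (isLowerSet_Iic y))).imp (key x y) (key y x)
  · rintro ⟨h₁, h₂⟩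
    refine ⟨Finite.of_injective
      (fun S : Emb injectiveMorphisms X => Set.range (toFun S.1.arrow.hom))
      fun S T h => Subtype.ext (range_arrow_injective h), fun S T => ?_⟩
    rw [emb_le_iff, emb_le_iff]
    by_contra! h
    obtain ⟨⟨x, hx, hx'⟩, ⟨y, hy, hy'⟩⟩ := And.imp Set.not_subset.1 Set.not_subset.1 h
    rcases h₂ x y with h | h
    · exact hx' (isLowerSet_range _ h hy)
    · exact hy' (isLowerSet_range _ h hx)

theorem isPath_below (x : X.obj.carrier) : isPath injectiveMorphisms (below x) :=
  isPath_iff.2 ⟨X.obj.finite_Iic x, below_total x⟩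

theorem exists_top_of_isPath (hX : isPath injectiveMorphisms X) [Nonempty X.obj.carrier] :
    ∃ t : X.obj.carrier, ∀ x, x ≤ t := by
  obtain ⟨h₁, h₂⟩ := isPath_iff.1 hX
  obtain ⟨t, ht⟩ := Finite.exists_max (ht (X := X.obj))
  refine ⟨t, fun x => (h₂ x t).elim id fun h => (eq_of_le_of_ht_le h (ht x)).ge⟩

theorem exists_hom_of_top {t : X.obj.carrier} (h : ∀ x, x ≤ t) (y : Y.obj.carrier)
    (hy : ht y = ht t) : ∃ f : X ⟶ Y, toFun f.hom t = y := by
  have hle (x : X.obj.carrier) : ht x ≤ ht y := hy ▸ ht_strictMono.monotone (h x)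
  refine ⟨ObjectProperty.homMk (Forest.homMk (fun x => anc y (ht x)) (fun x x' hx => ?_)
    fun x => ht_anc y (hle x)), anc_eq le_rfl hy⟩
  change anc y (ht x) ≤ anc y (ht x')
  rw [anc_eq_of_le (anc_le y (ht x')) (by
    rw [ht_anc y (hle x')]
    exact ht_strictMono.monotone hx)]
  exact anc_le _ _

theorem hom_ext_of_top {t : X.obj.carrier} (h : ∀ x, x ≤ t) {f g : X ⟶ Y}
    (hfg : toFun f.hom t = toFun g.hom t) : f = g := hom_ext fun x =>
  eq_of_le_of_ht_eq (map_le f.hom (h x)) (hfg ▸ map_le g.hom (h x)) (by simp)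

/-- A path with a largest element of height `n` represents the functor of nodes of height `n`. -/
theorem isFinitelyPresentable_of_isPath (hX : isPath injectiveMorphisms X) :
    IsFinitelyPresentable.{w} X := by
  rw [isFinitelyPresentable_iff_preservesFilteredColimitsOfSize]
  have := preservesFilteredColimits_ι.{w}
  refine ⟨fun J _ _ => ⟨fun {D} => ⟨fun {c} hc => ?_⟩⟩⟩
  have hc' := isColimitOfPreserves isDeterministicForest.ι hc
  rcases isEmpty_or_nonempty X.obj.carrier with hX' | hX'
  · refine ⟨Types.FilteredColimit.isColimitOf _ _ (fun f => ?_) (fun i j f g h => ?_)⟩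
    · obtain ⟨j⟩ := IsFiltered.nonempty (C := J)
      let l : X ⟶ D.obj j := ObjectProperty.homMk
        (Forest.homMk (fun x => hX'.elim x) (fun x => hX'.elim x) fun x => hX'.elim x)
      exact ⟨j, l, hom_ext fun x => hX'.elim x⟩
    · exact ⟨_, IsFiltered.leftToMax i j, IsFiltered.rightToMax i j,
        hom_ext fun x => hX'.elim x⟩
  · obtain ⟨t, ht⟩ := exists_top_of_isPath hX
    refine ⟨Types.FilteredColimit.isColimitOf _ _ (fun f => ?_) (fun i j f g h => ?_)⟩
    · obtain ⟨j, y, hy⟩ := Forest.exists_of_isColimit hc' (toFun (f : X ⟶ c.pt).hom t)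
      obtain ⟨g, hg⟩ := exists_hom_of_top ht (Y := D.obj j) y (by
        rw [← ht_map (c.ι.app j).hom]
        exact (congrArg Forest.ht hy).trans (ht_map _ t))
      exact ⟨j, g, hom_ext_of_top ht (hy.symm.trans (congrArg (toFun (c.ι.app j).hom) hg.symm))⟩
    · obtain ⟨k, u, v, hk⟩ := Forest.exists_eq_of_isColimit hc'
        (toFun (f : X ⟶ D.obj i).hom t) (toFun (g : X ⟶ D.obj j).hom t)
        (congr_toFun (X := X) (Y := c.pt) h t)
      exact ⟨k, u, v, hom_ext_of_top ht hk⟩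

end DetForest

/-! ### Deterministic forests form an arboreal category -/

namespace DetForest

open Forest

variable {X Y : DetForest.{w}}

/-- Colimit cocones of deterministic forests are jointly surjective. -/
theorem exists_of_isColimit {J : Type*} [Category* J] {D : J ⥤ DetForest.{w}} {c : Cocone D}
    (hc : IsColimit c) (x : c.pt.obj.carrier) :
    ∃ (j : J) (y : (D.obj j).obj.carrier), toFun (c.ι.app j).hom y = x := by
  -- The colimit maps factor through their joint image, whose inclusion is therefore split epi.
  let S : Set c.pt.obj.carrier := {x | ∃ j, x ∈ Set.range (toFun (c.ι.app j).hom)}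
  have hS : IsLowerSet S := fun _ _ h ⟨j, hj⟩ => ⟨j, isLowerSet_range _ h hj⟩
  have := mono_of_injective _ (injective_subι S hS)
  have hl (j : J) : ∃ l, l ≫ c.pt.subι S hS = c.ι.app j :=
    exists_lift (c.ι.app j) _ (injective_subι S hS) fun z => ⟨⟨_, j, z, rfl⟩, rfl⟩
  choose l hl using hl
  let s : Cocone D :=
    { pt := c.pt.sub S hS
      ι :=
        { app := l
          naturality i j f := by
            rw [← cancel_mono (c.pt.subι S hS), Category.assoc, hl, c.w]
            exact (hl i).symm } }
  have e : hc.desc s ≫ c.pt.subι S hS = 𝟙 c.pt := hc.hom_ext fun j => by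
    rw [hc.fac_assoc, Category.comp_id]
    exact hl j
  obtain ⟨j, y, hy⟩ := (toFun (hc.desc s).hom x).2
  exact ⟨j, y, hy.trans (congr_toFun e x)⟩

theorem isConnectedObj_of_isPath (hX : isPath injectiveMorphisms X) :
    IsConnectedObj.{w} injectiveMorphisms X := by
  intro I _ P hP c ⟨hc⟩ f
  have hinj (i : I) : injectiveMorphisms (c.inj i) := injective_of_total (isPath_iff.1 (hP i)).2 _
  rcases isEmpty_or_nonempty X.obj.carrier with hX' | hX'
  · obtain ⟨i⟩ := ‹Nonempty I›
    obtain ⟨l, hl⟩ := exists_lift f (c.inj i) (hinj i) fun x => hX'.elim x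
    exact ⟨i, l, hl⟩
  · obtain ⟨t, ht⟩ := exists_top_of_isPath hX
    obtain ⟨⟨i⟩, y, hy⟩ := exists_of_isColimit hc (toFun f.hom t)
    obtain ⟨l, hl⟩ := exists_lift f (c.inj i) (hinj i) fun x =>
      isLowerSet_range (c.inj i) (map_le f.hom (ht x)) ⟨y, hy⟩
    exact ⟨i, l, hl⟩

/-- The path embedding of the nodes below `x`, as an object of the diagram of path embeddings. -/
def belowOver (x : X.obj.carrier) : (isPathEmbedding injectiveMorphisms X).FullSubcategory :=
  ⟨Over.mk (belowι x), isPath_below x, injective_belowι x⟩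

/-- The components of a cocone over the path embeddings are determined by its values at the largest
elements of the paths `below x`. -/
theorem cocone_app_eq
    (s : Cocone ((isPathEmbedding injectiveMorphisms X).ι ⋙ Over.forget X))
    (f : (isPathEmbedding injectiveMorphisms X).FullSubcategory) (p : f.obj.left.obj.carrier) :
    toFun (s.ι.app f).hom p =
      toFun (s.ι.app (belowOver (toFun f.obj.hom.hom p))).hom (belowTop _) := by
  obtain ⟨l, hl⟩ := exists_lift (belowι (toFun f.obj.hom.hom p)) f.obj.hom f.property.2
    fun z => isLowerSet_range f.obj.hom z.2 ⟨p, rfl⟩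
  let φ : belowOver (toFun f.obj.hom.hom p) ⟶ f := ObjectProperty.homMk (Over.homMk l hl)
  have h₁ := congr_toFun (s.w φ) (belowTop _)
  have h₂ : toFun l.hom (belowTop _) = p := f.property.2 (congr_toFun hl (belowTop _))
  exact (congrArg (toFun (s.ι.app f).hom) h₂.symm).trans h₁

theorem isPathGenerated (X : DetForest.{w}) : IsPathGenerated injectiveMorphisms X := by
  have hanc (s : Cocone ((isPathEmbedding injectiveMorphisms X).ι ⋙ Over.forget X))
      {x y : X.obj.carrier} (h : x ≤ y) :=
    cocone_app_eq s (belowOver y) (⟨x, h⟩ : Set.Iic y)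
  refine ⟨⟨fun s => ObjectProperty.homMk (Forest.homMk
    (fun x => toFun (s.ι.app (belowOver x)).hom (belowTop x)) (fun x y h => ?_) fun x => ?_),
    fun s f => hom_ext fun p => (cocone_app_eq s f p).symm, fun s m hm => hom_ext fun x => ?_⟩⟩
  · refine (hanc s h).ge.trans (map_le _ ?_)
    exact h
  · exact (ht_map _ _).trans (ht_map (belowι x).hom (belowTop x)).symm
  · exact congr_toFun (hm (belowOver x)) (belowTop x)

attribute [local instance] Cardinal.fact_isRegular_aleph0

theorem isArborealCategory :
    IsArborealCategory.{w} surjectiveMorphisms.{w} injectiveMorphisms.{w} where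
  locallySmall := inferInstance
  wellPowered := ⟨fun X => small_of_injective (range_arrow_injective (X := X))⟩
  stableFactorisationSystem := isStableFactorisationSystem
  two_out_of_three {P₁ P₂ P₃} h₁ h₂ h₃ f g h y := by
    obtain ⟨x, hx⟩ := h (toFun g.hom y)
    exact ⟨x, injective_of_total (isPath_iff.1 h₂).2 g hx⟩
  hasCoproducts_paths I P _ := by
    have := isLocallyFinitelyPresentable.{w}
    infer_instance
  connected_paths _ := isConnectedObj_of_isPath
  pathGenerated := isPathGenerated
  essentiallySmall_paths := by
    have := isLocallyFinitelyPresentable.{w}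
    have : ObjectProperty.EssentiallySmall.{w} (isPath injectiveMorphisms.{w}) :=
      ObjectProperty.EssentiallySmall.of_le
        (Q := isCardinalPresentable DetForest.{w} Cardinal.aleph0.{w})
        fun _ => isFinitelyPresentable_of_isPath
    infer_instance

end DetForest

/-! ### Detection of path embeddings -/

theorem isHornTheory_detTheory : IsHornTheory detTheory := by
  rintro _ rfl
  exact ⟨.inf (.atomic (.rel _ _)) (.atomic (.rel _ _)), .atomic (.equal _ _)⟩

theorem isCartesianTheory_detTheory : IsCartesianTheory detTheory := by
  refine ⟨fun _ _ => False, ⟨fun _ => ⟨_, fun _ h => h.elim⟩⟩, ?_⟩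
  rintro _ rfl
  exact ⟨.inf (.atomic (.rel _ _)) (.atomic (.rel _ _)), .atomic (.equal _ _)⟩

theorem isDeterministicGraph_iff_isModel (G : Gph.{w}) :
    isDeterministicGraph G ↔ isModel detTheory G := by
  have key : isModel detTheory G ↔ ∀ x : Fin 3 → G.carrier,
      G.E (x 0) (x 1) ∧ G.E (x 0) (x 2) → x 1 = x 2 := by
    simp only [isModel, detTheory, Set.mem_singleton_iff, forall_eq, Sequent.Valid, detSequent,
      FirstOrder.Language.BoundedFormula.realize_inf,
      FirstOrder.Language.BoundedFormula.realize_rel₂,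
      FirstOrder.Language.BoundedFormula.realize_bdEqual, FirstOrder.Language.Term.realize_var,
      Sum.elim_inr, Gph.E]
  rw [key]
  constructor
  · exact fun h x hx => h _ _ _ hx.1 hx.2
  · exact fun h x y z hy hz => h ![x, y, z] ⟨hy, hz⟩

namespace DetForest

open Forest

variable {X Y : DetForest.{w}}

theorem injective_iff_isStrEmbedding (f : X ⟶ Y) (hX : isPath injectiveMorphisms X) :
    injectiveMorphisms f ↔ IsStrEmbedding (detCoverGraph.map f).hom := by
  refine ⟨fun hf => ⟨hf, fun n r x h => ?_⟩, fun h => h.1⟩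
  cases r
  let a : X.obj.carrier := x 0
  let b : X.obj.carrier := x 1
  change toFun f.hom a ⋖ toFun f.hom b at h
  change a ⋖ b
  have hh := ht_covBy h
  rw [ht_map, ht_map] at hh
  refine covBy_iff.2 ⟨((isPath_iff.1 hX).2 a b).resolve_right fun h' => ?_, hh⟩
  have := ht_strictMono.monotone h'
  omega

theorem detectsPathEmbeddings :
    DetectsPathEmbeddings injectiveMorphisms.{w} isDeterministicGraph.{w} detWalkAdjunction where
  cartesian := ⟨detTheory, isCartesianTheory_detTheory, isDeterministicGraph_iff_isModel⟩
  finitelyPresentable_paths _ := isFinitelyPresentable_of_isPath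
  detects := injective_iff_isStrEmbedding

end DetForest

/-! ### Failure of the factorisation property -/

namespace Gph

attribute [local instance] Cardinal.fact_isRegular_aleph0

/-- The graph on a given set with all possible edges. -/
def codiscrete : Type w ⥤ Gph.{w} where
  obj S := mk S fun _ _ => True
  map {S T} f := homMk (G := mk S _) (H := mk T _) (fun x => f x) fun _ _ _ => trivial

/-- Functions on the vertices of `G` are morphisms from `G` to a codiscrete graph. -/
def verticesAdjunction : vertices.{w} ⊣ codiscrete.{w} :=
  Adjunction.mkOfHomEquiv
    { homEquiv := fun _ S =>
        { toFun := fun f => homMk (H := mk S _) (fun x => f x) fun _ _ _ => trivial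
          invFun := fun g => ↾(Str.toFun g)
          left_inv := fun _ => rfl
          right_inv := fun _ => rfl }
      homEquiv_naturality_left_symm := fun _ _ => rfl
      homEquiv_naturality_right := fun _ _ => rfl }

theorem preservesFilteredColimits_codiscrete :
    PreservesFilteredColimitsOfSize.{w, w} codiscrete.{w} := by
  refine ⟨fun J _ _ => ⟨fun {D} => ⟨fun {c} hc => ⟨?_⟩⟩⟩⟩
  refine isColimitOfVertices _ (show IsColimit c from hc) fun a b _ => ?_
  obtain ⟨i, x, rfl⟩ := Types.jointly_surjective_of_isColimit hc (a : c.pt)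
  obtain ⟨j, y, rfl⟩ := Types.jointly_surjective_of_isColimit hc (b : c.pt)
  exact ⟨IsFiltered.max i j, D.map (IsFiltered.leftToMax i j) x,
    D.map (IsFiltered.rightToMax i j) y, trivial,
    ConcreteCategory.congr_hom (c.w _) x, ConcreteCategory.congr_hom (c.w _) y⟩

/-- A left adjoint functor to graphs with finitary right adjoint sends finitely presentable objects
to graphs with finitely many vertices. -/
theorem finite_of_isFinitelyPresentable {C : Type u} [Category.{v} C] {L : C ⥤ Gph.{w}}
    {R : Gph.{w} ⥤ C} (adj : L ⊣ R) (hR : PreservesFilteredColimitsOfSize.{w, w} R) (X : C)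
    [IsFinitelyPresentable.{w} X] : Finite (L.obj X).carrier := by
  have := preservesFilteredColimits_codiscrete.{w}
  have : PreservesFilteredColimitsOfSize.{w, w} (codiscrete.{w} ⋙ R) :=
    ⟨fun J _ _ => inferInstance⟩
  have : (codiscrete.{w} ⋙ R).IsCardinalAccessible Cardinal.aleph0.{w} :=
    Functor.IsFinitelyAccessible_iff_preservesFilteredColimitsOfSize.2 this
  have := (adj.comp verticesAdjunction).isCardinalPresentable_leftAdjoint_obj
    Cardinal.aleph0.{w} X
  exact (hasCardinalLT_aleph0_iff _).1 ((Types.isCardinalPresentable_iff _).1 this)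

theorem surjective_of_epi {G H : Gph.{w}} (f : G ⟶ H) [Epi f] :
    Function.Surjective (Str.toFun f) := by
  have := verticesAdjunction.{w}.isLeftAdjoint
  exact (epi_iff_surjective (vertices.map f)).1 inferInstance

end Gph

namespace DetForest

open Forest

/-- The infinite branch. -/
def omega : DetForest.{w} where
  obj :=
    { carrier := ULift.{w} ℕ
      finite_Iic n := Set.Finite.of_finite_image (f := ULift.down)
        ((Set.finite_Iic n.down).subset (by rintro _ ⟨m, hm, rfl⟩; exact hm))
        ULift.down_injective.injOn
      isChain_Iic _ m _ n _ _ := le_total m n }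
  property _ _ _ h h' := CovBy.unique_right h h'

/-- A morphism from a branch to a deterministic forest is determined by its value at the root. -/
theorem epi_belowι_omega :
    Epi (belowι (X := omega.{w}) (⟨0⟩ : ULift.{w} ℕ)) where
  left_cancellation {Y} f g h := hom_ext fun n =>
    map_eq_of_le Y.property f.hom g.hom (congr_toFun h (belowTop _)) (Nat.zero_le n.down)

/-- If the adjunction factored through graphs, the root of the infinite branch would be sent to a
finite graph, and so would the whole branch, because the inclusion of the root is an epimorphism.
But the reflection of a finite graph into deterministic graphs is finite. -/
theorem not_factorisationProperty :
    ¬ FactorisationProperty isDeterministicGraph.{w} detWalkAdjunction.{w} := by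
  rintro ⟨F, adjF, L, R, adj, hadj, ⟨e⟩⟩
  have := isFinitelyPresentable_of_isPath (isPath_below (X := omega.{w}) (⟨0⟩ : ULift.{w} ℕ))
  have h₁ := Gph.finite_of_isFinitelyPresentable adj hadj.finitary
    (below (X := omega.{w}) (⟨0⟩ : ULift.{w} ℕ))
  have := adj.isLeftAdjoint
  have := epi_belowι_omega.{w}
  have h₂ : Finite (L.obj omega).carrier :=
    Finite.of_surjective _ (Gph.surjective_of_epi (L.map (belowι (X := omega) ⟨0⟩)))
  let i : detReflection.obj (L.obj omega) ≅ detCoverGraph.obj omega :=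
    ((adjF.leftAdjointUniq DetGph.detAdjunction).app (L.obj omega)).symm ≪≫ e.app omega
  have h₃ : Finite (detReflection.obj (L.obj omega)).obj.carrier :=
    inferInstanceAs (Finite (Quotient (detSetoid (L.obj omega))))
  have h₄ : Finite (detCoverGraph.obj omega.{w}).obj.carrier :=
    Finite.of_surjective (Str.toFun i.hom.hom) fun y =>
      ⟨Str.toFun i.inv.hom y, congrArg (fun t => Str.toFun t.hom y) i.inv_hom_id⟩
  exact not_finite_iff_infinite.2 (inferInstance : Infinite (ULift.{w} ℕ)) h₄

end DetForest

end Arboreal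

open Arboreal
theorem mainTheorem12 :
    -- the objects of `DetForest` are the forests which are disjoint unions of branches
    (∀ X : Forest.{w}, isDeterministicForest X ↔
      ∃ (I : Type w) (branch : X.carrier → I),
        ∀ x y, branch x = branch y ↔ x ≤ y ∨ y ≤ x) ∧
    -- deterministic graphs are the models of a Horn theory
    (IsHornTheory detTheory ∧ ∀ G : Gph.{w}, isDeterministicGraph G ↔ isModel detTheory G) ∧
    -- the adjunction between forests and graphs
    (∃ adj : coverGraph.{w} ⊣ walkForest.{w}, IsFinitelyAccessibleAdjunction.{w} adj) ∧
    -- the reflection of graphs into deterministic graphs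
    (∃ adj : detReflection.{w} ⊣ detInclusion.{w}, IsFinitelyAccessibleAdjunction.{w} adj) ∧
    -- the restricted adjunction between forests of disjoint branches and deterministic graphs
    (∃ adj : detCoverGraph.{w} ⊣ detWalkForest.{w},
      IsFinitelyAccessibleArborealAdjunction.{w} surjectiveMorphisms.{w}
        injectiveMorphisms.{w} adj ∧
      DetectsPathEmbeddings injectiveMorphisms.{w} isDeterministicGraph.{w} adj ∧
      ¬ FactorisationProperty isDeterministicGraph.{w} adj) :=
  ⟨fun _ => Forest.isDeterministicForest_iff,
    ⟨isHornTheory_detTheory, isDeterministicGraph_iff_isModel⟩,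
    ⟨_, Forest.isFinitelyAccessibleAdjunction_walkAdjunction⟩,
    ⟨_, DetGph.isFinitelyAccessibleAdjunction_detAdjunction⟩,
    ⟨_, ⟨DetForest.isArborealCategory,
        DetForest.isFinitelyAccessibleAdjunction_detWalkAdjunction⟩,
      DetForest.detectsPathEmbeddings, DetForest.not_factorisationProperty⟩⟩
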